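/- Let $p$ be a prime, let $d\ge 1$, and let $\Gamma$ be a topological group isomorphic to $\mathbb{Z}_p^d$, written multiplicatively. Let $\Lambda=\Lambda(\Gamma)=\mathbb{Z}_p[[\Gamma]]=\varprojlim_U \mathbb{Z}_p[\Gamma/U]$ ($U$ running over the open subgroups of $\Gamma$) be its Iwasawa algebra, and for $n\ge 0$ let $I_n$ be the kernel of the projection $\Lambda\to\mathbb{Z}_p[\Gamma/\Gamma^{p^n}]$. Let $\mu_{p^\infty}\subset\overline{\mathbb{Q}}_p^{\times}$ be the group of roots of unity of $p$-power order. For $\gamma\in\Gamma\setminus\Gamma^p$ and $\zeta\in\mu_{p^\infty}$ put $$f_{\gamma,\zeta}=\prod_{\sigma\in\mathrm{Gal}(\mathbb{Q}_p(\zeta)/\mathbb{Q}_p)}(\gamma-\sigma(\zeta))\in\Lambda ;$$ the elements of $\Lambda$ of this form are called simple. Let $\mathcal{E}_n=p^{n(d-2)}$ if $d\ge 2$, and $\mathcal{E}_n=1$ if $d=1$. Let $J$ be an ideal of $\Lambda$. (1) If $J=(f_{\gamma,\zeta}^m)$ for some $\gamma\in\Gamma\setminus\Gamma^p$, some $\zeta\in\mu_{p^\infty}$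 and some positive integer $m$, then $$\operatorname{rank}_{\mathbb{Z}_p}\Lambda/(I_n+J)=[\mathbb{Q}_p(\zeta):\mathbb{Q}_p]\cdot p^{n(d-1)}\qquad\text{for all sufficiently large } n.$$ (2) If $J=(f)$ for some $f\in\Lambda$ that is not divisible by any simple element, or if $(f,g)\subset J$ for some relatively prime elements $f,g\in\Lambda$, then $$\operatorname{rank}_{\mathbb{Z}_p}\Lambda/(I_n+J)=O(\mathcal{E}_n)\qquad\text{as } n\to\infty.$$ -/

import Mathlib

open Polynomial IntermediateField Filter Asymptotics

noncomputable section

namespace Iwasawa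

section CompletedGroupAlgebra

/-- The projection `G/U → G/V` for open subgroups `U ≤ V` of a commutative topological group. -/
def quotientMap {G : Type*} [CommGroup G] [TopologicalSpace G] {U V : OpenSubgroup G}
    (h : U ≤ V) : G ⧸ (U : Subgroup G) →* G ⧸ (V : Subgroup G) :=
  QuotientGroup.map (U : Subgroup G) (V : Subgroup G) (MonoidHom.id G) (fun _ hx => h hx)

/-- The projection `R[G/U] → R[G/V]` for open subgroups `U ≤ V`. -/
def transition (R : Type*) {G : Type*} [CommRing R] [CommGroup G] [TopologicalSpace G]
    {U V : OpenSubgroup G} (h : U ≤ V) :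
    MonoidAlgebra R (G ⧸ (U : Subgroup G)) →ₐ[R] MonoidAlgebra R (G ⧸ (V : Subgroup G)) :=
  MonoidAlgebra.mapDomainAlgHom R R (quotientMap h)

/-- The completed group algebra `R[[G]] = lim R[G/U]` of a commutative topological group `G`, where
`U` runs through the open subgroups of `G`: the families `(x_U)`, `x_U ∈ R[G/U]`, such that the
projection `R[G/U] → R[G/V]` sends `x_U` to `x_V` whenever `U ≤ V`. -/
def completedGroupAlgebra (R G : Type*) [CommRing R] [CommGroup G] [TopologicalSpace G] :
    Subalgebra R (∀ U : OpenSubgroup G, MonoidAlgebra R (G ⧸ (U : Subgroup G))) where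
  carrier := {x | ∀ (U V : OpenSubgroup G) (h : U ≤ V), transition R h (x U) = x V}
  mul_mem' hx hy U V h := by
    rw [Pi.mul_apply, map_mul, hx U V h, hy U V h, Pi.mul_apply]
  add_mem' hx hy U V h := by
    rw [Pi.add_apply, map_add, hx U V h, hy U V h, Pi.add_apply]
  algebraMap_mem' r U V h := by
    rw [Pi.algebraMap_apply, AlgHom.commutes, Pi.algebraMap_apply]

variable {R G : Type*} [CommRing R] [CommGroup G] [TopologicalSpace G]

/-- The canonical map `G → R[[G]]`. -/
def ofGroup (R : Type*) {G : Type*} [CommRing R] [CommGroup G] [TopologicalSpace G] :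
    G →* completedGroupAlgebra R G where
  toFun γ := ⟨fun U => MonoidAlgebra.single (γ : G ⧸ (U : Subgroup G)) 1,
    fun _ _ _ => MonoidAlgebra.mapDomain_single⟩
  map_one' := rfl
  map_mul' a b := by
    ext U : 2
    exact map_mul (MonoidAlgebra.of R (G ⧸ (U : Subgroup G))) (a : G ⧸ (U : Subgroup G)) b

/-- The projection `R[[G]] → R[G/U]`. -/
def proj (R : Type*) {G : Type*} [CommRing R] [CommGroup G] [TopologicalSpace G]
    (U : OpenSubgroup G) :
    completedGroupAlgebra R G →ₐ[R] MonoidAlgebra R (G ⧸ (U : Subgroup G)) :=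
  (Pi.evalAlgHom R _ U).comp (completedGroupAlgebra R G).val

theorem proj_surjective (U : OpenSubgroup G) : Function.Surjective (proj R U) := by
  have key : ∀ (x : MonoidAlgebra R (G ⧸ (U : Subgroup G))), x ∈ (proj R U).range := by
    intro x
    induction x using MonoidAlgebra.induction_on with
    | of g =>
      obtain ⟨γ, rfl⟩ := QuotientGroup.mk_surjective g
      exact ⟨ofGroup R γ, rfl⟩
    | add x y hx hy => exact add_mem hx hy
    | smul r x hx => exact Subalgebra.smul_mem _ hx r
  exact key

/-- The map `R[[G]] → S[[G]]` induced by a homomorphism of coefficient rings `R → S`. -/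
def mapCoeff (G : Type*) [CommGroup G] [TopologicalSpace G] {S : Type*} [CommRing S]
    (φ : R →+* S) : completedGroupAlgebra R G →+* completedGroupAlgebra S G where
  toFun x := ⟨fun U => MonoidAlgebra.mapRingHom _ φ (x.1 U), by
    intro U V h
    change _ = MonoidAlgebra.mapRingHom _ φ (x.1 V)
    rw [← x.2 U V h]
    exact (DFunLike.congr_fun (MonoidAlgebra.mapRingHom_comp_mapDomainRingHom φ
      (quotientMap h)) (x.1 U)).symm⟩
  map_one' := by ext U : 2; exact map_one _
  map_mul' a b := by ext U : 2; exact map_mul _ _ _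
  map_zero' := by ext U : 2; exact map_zero _
  map_add' a b := by ext U : 2; exact map_add _ _ _

theorem mapCoeff_injective {S : Type*} [CommRing S] {φ : R →+* S} (hφ : Function.Injective φ) :
    Function.Injective (mapCoeff G φ) := by
  intro x y hxy
  ext U g
  have h1 := congrArg (fun z => (z.1 U).coeff g) hxy
  exact hφ (by simpa [mapCoeff] using h1)

theorem mapCoeff_ofGroup {S : Type*} [CommRing S] (φ : R →+* S) (γ : G) :
    mapCoeff G φ (ofGroup R γ) = ofGroup S γ := by
  ext U : 2
  simp [mapCoeff, ofGroup]

theorem mapCoeff_algebraMap {S : Type*} [CommRing S] (φ : R →+* S) (r : R) :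
    mapCoeff G φ (algebraMap R _ r) = algebraMap S _ (φ r) := by
  ext U : 2
  exact MonoidAlgebra.mapRingHom_single _ _ _

end CompletedGroupAlgebra

section SimpleElements

variable (p : ℕ) [Fact p.Prime] {Γ : Type*} [CommGroup Γ] [TopologicalSpace Γ]

/-- `ζ` belongs to the group `μ_{p^∞}` of roots of unity of `p`-power order in an algebraic closure
of `ℚ_p`. -/
def IsPPowerRootOfUnity (ζ : AlgebraicClosure ℚ_[p]) : Prop :=
  ∃ k : ℕ, ζ ^ p ^ k = 1

/-- The element `f_{γ,ζ} = ∏_σ (γ - σ(ζ))` of `Λ(Γ) = ℤ_p[[Γ]]`, where `σ` runs through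
`Gal(ℚ_p(ζ)/ℚ_p)`. It is obtained by substituting `γ` for the variable in the polynomial
`∏_σ (X - σ(ζ)) ∈ ℤ_p[X]`, the minimal polynomial of `ζ`; see `mapCoeff_simpleElement` for the
product formula, which determines the element by `mapCoeff_injective`. -/
def simpleElement (γ : Γ) (ζ : AlgebraicClosure ℚ_[p]) : completedGroupAlgebra ℤ_[p] Γ :=
  aeval (ofGroup ℤ_[p] γ) (minpoly ℤ_[p] ζ)

instance finiteDimensional_adjoin (ζ : AlgebraicClosure ℚ_[p]) :
    FiniteDimensional ℚ_[p] ℚ_[p]⟮ζ⟯ :=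
  adjoin.finiteDimensional (Algebra.IsIntegral.isIntegral ζ)

theorem isGalois_adjoin {ζ : AlgebraicClosure ℚ_[p]} (hζ : IsPPowerRootOfUnity p ζ) :
    IsGalois ℚ_[p] ℚ_[p]⟮ζ⟯ := by
  obtain ⟨k, hk⟩ := hζ
  have hp : 0 < p ^ k := pow_pos (Fact.out : p.Prime).pos k
  have : NeZero (orderOf ζ) := ⟨(orderOf_pos_iff.2 (isOfFinOrder_iff_pow_eq_one.2 ⟨_, hp, hk⟩)).ne'⟩
  have := (IsPrimitiveRoot.orderOf ζ).intermediateField_adjoin_isCyclotomicExtension ℚ_[p]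
  exact IsCyclotomicExtension.isGalois {orderOf ζ} ℚ_[p] _

theorem isIntegral_of_isPPowerRootOfUnity {ζ : AlgebraicClosure ℚ_[p]}
    (hζ : IsPPowerRootOfUnity p ζ) : IsIntegral ℤ_[p] ζ := by
  obtain ⟨k, hk⟩ := hζ
  exact IsIntegral.of_pow (pow_pos (Fact.out : p.Prime).pos k) (hk ▸ isIntegral_one)

theorem map_minpoly_eq_prod {ζ : AlgebraicClosure ℚ_[p]} (hζ : IsPPowerRootOfUnity p ζ) :
    (minpoly ℤ_[p] ζ).map (algebraMap ℤ_[p] ℚ_[p]⟮ζ⟯) =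
      ∏ σ : (ℚ_[p]⟮ζ⟯ ≃ₐ[ℚ_[p]] ℚ_[p]⟮ζ⟯), (X - C (σ (AdjoinSimple.gen ℚ_[p] ζ))) := by
  have := isGalois_adjoin p hζ
  have hint : IsIntegral ℚ_[p] ζ := Algebra.IsIntegral.isIntegral ζ
  set g := AdjoinSimple.gen ℚ_[p] ζ with hg
  have h1 : (minpoly ℤ_[p] ζ).map (algebraMap ℤ_[p] ℚ_[p]⟮ζ⟯) =
      (minpoly ℚ_[p] g).map (algebraMap ℚ_[p] ℚ_[p]⟮ζ⟯) := by
    rw [hg, minpoly_gen, minpoly.isIntegrallyClosed_eq_field_fractions' ℚ_[p]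
      (isIntegral_of_isPPowerRootOfUnity p hζ), Polynomial.map_map,
      ← IsScalarTower.algebraMap_eq]
  rw [h1]
  have hinj : Function.Injective fun σ : (ℚ_[p]⟮ζ⟯ ≃ₐ[ℚ_[p]] ℚ_[p]⟮ζ⟯) => σ g := by
    intro σ τ h
    have h2 : (σ : ℚ_[p]⟮ζ⟯ →ₐ[ℚ_[p]] ℚ_[p]⟮ζ⟯) = τ :=
      (adjoin.powerBasis hint).algHom_ext (by simpa using h)
    ext x
    exact congrArg Subtype.val (DFunLike.congr_fun h2 x)
  refine (Polynomial.eq_of_monic_of_associated (monic_prod_of_monic _ _ fun _ _ => monic_X_sub_C _)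
    ((minpoly.monic (Algebra.IsIntegral.isIntegral g)).map _)
    (associated_of_dvd_of_natDegree_le ?_ ?_ ?_)).symm
  · refine Finset.prod_dvd_of_coprime (fun σ _ τ _ h => ?_) (fun σ _ => ?_)
    · exact pairwise_coprime_X_sub_C hinj h
    · rw [dvd_iff_isRoot, IsRoot, eval_map_algebraMap]
      have := minpoly.aeval ℚ_[p] g
      have h3 := congrArg σ this
      rw [map_zero, ← AlgEquiv.coe_toAlgHom, ← aeval_algHom_apply] at h3
      exact h3
  · exact ((minpoly.monic (Algebra.IsIntegral.isIntegral g)).map _).ne_zero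
  · rw [natDegree_map, natDegree_prod_of_monic _ _ fun _ _ => monic_X_sub_C _]
    simp only [natDegree_X_sub_C, Finset.sum_const, Finset.card_univ, smul_eq_mul, mul_one]
    rw [← Nat.card_eq_fintype_card, IsGalois.card_aut_eq_finrank, adjoin.finrank hint, hg,
      minpoly_gen]

theorem mapCoeff_simpleElement (γ : Γ) {ζ : AlgebraicClosure ℚ_[p]}
    (hζ : IsPPowerRootOfUnity p ζ) :
    mapCoeff Γ (algebraMap ℤ_[p] ℚ_[p]⟮ζ⟯) (simpleElement p γ ζ) =
      ∏ σ : (ℚ_[p]⟮ζ⟯ ≃ₐ[ℚ_[p]] ℚ_[p]⟮ζ⟯),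
        (ofGroup ℚ_[p]⟮ζ⟯ γ - algebraMap ℚ_[p]⟮ζ⟯ _ (σ (AdjoinSimple.gen ℚ_[p] ζ))) := by
  have h1 : mapCoeff Γ (algebraMap ℤ_[p] ℚ_[p]⟮ζ⟯) (simpleElement p γ ζ) =
      aeval (ofGroup ℚ_[p]⟮ζ⟯ γ) ((minpoly ℤ_[p] ζ).map (algebraMap ℤ_[p] ℚ_[p]⟮ζ⟯)) := by
    rw [simpleElement, aeval_def, hom_eval₂, mapCoeff_ofGroup, aeval_def, eval₂_map]
    congr 1
    ext1 r
    exact mapCoeff_algebraMap _ r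
  rw [h1, map_minpoly_eq_prod p hζ, map_prod]
  simp only [map_sub, aeval_X, aeval_C]

/-- An element of `Λ(Γ)` is simple if it equals `f_{γ,ζ}` for some `γ ∈ Γ - Γ^p` and some
`ζ ∈ μ_{p^∞}`. -/
def IsSimpleElement (f : completedGroupAlgebra ℤ_[p] Γ) : Prop :=
  ∃ (γ : Γ) (ζ : AlgebraicClosure ℚ_[p]), (¬ ∃ δ : Γ, δ ^ p = γ) ∧ IsPPowerRootOfUnity p ζ ∧
    f = simpleElement p γ ζ

end SimpleElements

section Layers

variable {p : ℕ} [Fact p.Prime] {d : ℕ} {Γ : Type*} [CommGroup Γ] [TopologicalSpace Γ]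

theorem isOpen_range_pow (e : Γ ≃ₜ* Multiplicative (Fin d → ℤ_[p])) (n : ℕ) :
    IsOpen ((powMonoidHom (p ^ n) : Γ →* Γ).range : Set Γ) := by
  let B : Set (Fin d → ℤ_[p]) := Set.pi Set.univ fun _ =>
    Metric.closedBall (0 : ℤ_[p]) ((p : ℝ) ^ (-n : ℤ))
  have hr : (p : ℝ) ^ (-n : ℤ) ≠ 0 :=
    zpow_ne_zero _ (Nat.cast_ne_zero.2 (Fact.out : p.Prime).ne_zero)
  have hB : IsOpen B := isOpen_set_pi Set.finite_univ fun _ _ =>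
    IsUltrametricDist.isOpen_closedBall _ hr
  have h1 : ((powMonoidHom (p ^ n) : Γ →* Γ).range : Set Γ) =
      (fun x => Multiplicative.toAdd (e x)) ⁻¹' B := by
    ext x
    simp only [B, SetLike.mem_coe, MonoidHom.mem_range, powMonoidHom_apply, Set.mem_preimage,
      Set.mem_pi, Set.mem_univ, true_implies, mem_closedBall_zero_iff,
      PadicInt.norm_le_pow_iff_mem_span_pow, Ideal.mem_span_singleton]
    constructor
    · rintro ⟨y, rfl⟩ i
      refine ⟨Multiplicative.toAdd (e y) i, ?_⟩
      simp
    · intro h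
      choose y hy using h
      refine ⟨e.symm (Multiplicative.ofAdd y), ?_⟩
      apply e.injective
      rw [map_pow, ContinuousMulEquiv.apply_symm_apply]
      apply Multiplicative.toAdd.injective
      funext i
      rw [hy i]
      simp
  rw [h1]
  exact hB.preimage (continuous_toAdd.comp e.continuous)

/-- The open subgroup `Γ^{p^n} = Gal(L/K_n)` of `Γ = Gal(L/K) ≅ ℤ_p^d`, where `K_n` is the `n`-th
layer of `L/K`. -/
def layer (e : Γ ≃ₜ* Multiplicative (Fin d → ℤ_[p])) (n : ℕ) : OpenSubgroup Γ where
  toSubgroup := (powMonoidHom (p ^ n) : Γ →* Γ).range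
  isOpen' := isOpen_range_pow e n

/-- The ideal `I_n`, the kernel of the projection `Λ(Γ) → ℤ_p[Γ/Γ^{p^n}]`. -/
def layerIdeal (e : Γ ≃ₜ* Multiplicative (Fin d → ℤ_[p])) (n : ℕ) :
    Ideal (completedGroupAlgebra ℤ_[p] Γ) :=
  RingHom.ker (proj ℤ_[p] (layer e n))

/-- The modules whose ranks are computed are finitely generated, so `Module.finrank ℤ_[p]` is their
rank in the usual sense. -/
theorem finite_quotient (e : Γ ≃ₜ* Multiplicative (Fin d → ℤ_[p])) (n : ℕ)
    (J : Ideal (completedGroupAlgebra ℤ_[p] Γ)) :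
    Module.Finite ℤ_[p] (completedGroupAlgebra ℤ_[p] Γ ⧸ (layerIdeal e n ⊔ J)) := by
  have hfin : Finite (Γ ⧸ (layer e n : Subgroup Γ)) := by
    have : CompactSpace Γ := e.toHomeomorph.symm.compactSpace
    have : IsTopologicalGroup Γ :=
      Topology.IsInducing.topologicalGroup e e.toHomeomorph.isInducing
    exact Subgroup.quotient_finite_of_isOpen _ (layer e n).isOpen'
  let φ := Ideal.quotientKerAlgEquivOfSurjective (proj_surjective (R := ℤ_[p]) (layer e n))
  have h1 : Module.Finite ℤ_[p] (completedGroupAlgebra ℤ_[p] Γ ⧸ layerIdeal e n) :=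
    Module.Finite.equiv φ.symm.toLinearEquiv
  exact Module.Finite.of_surjective
    (Ideal.Quotient.factorₐ ℤ_[p] (le_sup_left : layerIdeal e n ≤ layerIdeal e n ⊔ J)).toLinearMap
    (Ideal.Quotient.factor_surjective le_sup_left)

end Layers

/-- The error term: `p^{n(d-2)}` for `d ≥ 2`, and `1` for `d = 1`. -/
def errorTerm (p d n : ℕ) : ℝ :=
  if 2 ≤ d then (p : ℝ) ^ (n * (d - 2)) else 1

end Iwasawa

end

/-!
The quotient `Λ/(I_n + J)` is a quotient of the group ring of the finite group `Γ/Γ^(p^n)`, and over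
`K = ℚ̄_p` the characters of this group form a basis of the linear forms on its group ring. As `J` is
an ideal, the linear forms that vanish on it are spanned by the characters that vanish on it, so the
rank of `Λ/(I_n + J)` is the number of characters `χ : Γ → Kˣ` killed by `p^n` at which `J` vanishes
(`finrank_quotient_eq_ncard`). The theorem becomes a statement about the number of these zeros.

For `J = (f_{γ,ζ}^m)` the zeros are the characters for which `χ(γ)` is conjugate to `ζ`. As `γ` is
not a `p`-th power, it can be completed to a basis of `Γ`, so each root of unity of order dividing
`p^n` is the value at `γ` of exactly `p^(n(d-1))` characters
(`ncard_torsionZeros_span_simpleElement_pow`).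

For the bound, the only property of `J` that is used is that it is not contained in `(s)` for any
simple `s`. In the first case this is the hypothesis; in the second, such an `s` would be a common
divisor of `f` and `g`, but a simple element has zeros and so is not a unit. Under this condition
the number of zeros is bounded by induction on `d` (`exists_ncard_torsionZeros_le`).

* If `d = 1`, there are no zeros at all: if `J` vanishes at `χ`, then Weierstrass division by the
  minimal polynomial of `ζ = χ(γ)`, `γ` a generator, shows that `J` is contained in `(f_{γ,ζ})`
  (`exists_isSimpleElement_of_mem_zeroLocus`).
* Let `Γ = Γ' × γ^ℤ_p`, so that the elements of `Λ(Γ)` are power series in `T = γ - 1` over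
  `Λ(Γ')`, and let `J'` be the ideal of `Λ(Γ')` generated by all coefficients of power series
  representing elements of `J`. Then `J` is contained in the extension of `J'`, so `J'` is not
  contained in `(s)` for a simple `s` either. As `Λ(Γ')` is noetherian, `J'` is generated by
  coefficients of index `< k` for some `k`. Let `χ` be a zero of `J` of order `p^m`, `m > k`, with
  `χ(γ)` of the same order and `χ|Γ'` of order at most `p^(m-k)`. The Galois group of `ℚ_p` acts on the roots
  of unity of order `p^m` through `(ℤ/p^m)^×`, so `χ` has at least `p^k` conjugates with the same
  restriction to `Γ'`, and all are zeros of `J`. A power series whose largest coefficient occurs at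
  an index `< k` has fewer than `k` zeros in the punctured open disc (`card_zeros_lt`), so all
  elements of `J'` vanish at `χ|Γ'` (`exists_coeff_ideal`).
* A character of exact order `p^m` is `x ↦ ω^(l(x))` for a linear form `l` with a unit coefficient.
  The condition above holds for all `l` near a given `l₀` in the decomposition of `Γ` for which `l₀`
  is the projection to the second factor. By compactness finitely many decompositions suffice, up to
  characters of bounded order (`exists_finite_slices`). Each zero of `J'` killed by `p^n` is the
  restriction of `p^n` characters killed by `p^n`, which gives the bound for `d` from that for
  `d - 1`.
-/

noncomputable section

namespace Iwasawa

/-! ### Functoriality and evaluation at characters -/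

section Functoriality

variable {R G H : Type*} [CommRing R] [CommGroup G] [TopologicalSpace G] [CommGroup H]
  [TopologicalSpace H]

theorem algHom_ext_of {M A : Type*} [Monoid M] [Semiring A] [Algebra R A]
    {f₁ f₂ : MonoidAlgebra R M →ₐ[R] A}
    (h : ∀ g, f₁ (MonoidAlgebra.single g 1) = f₂ (MonoidAlgebra.single g 1)) : f₁ = f₂ :=
  (MonoidAlgebra.lift R A M).symm.injective (MonoidHom.ext h)

/-- The homomorphism `G/φ⁻¹(V) → H/V` induced by a continuous homomorphism `φ : G → H`. -/
def comapQuotientMap (φ : G →ₜ* H) (V : OpenSubgroup H) :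
    G ⧸ (V.comap (φ : G →* H) φ.continuous : Subgroup G) →* H ⧸ (V : Subgroup H) :=
  QuotientGroup.map _ _ (φ : G →* H) fun _ hx => hx

/-- The homomorphism `R[[G]] → R[[H]]` induced by a continuous homomorphism `G → H`. -/
def mapGroup (R : Type*) [CommRing R] (φ : G →ₜ* H) :
    completedGroupAlgebra R G →ₐ[R] completedGroupAlgebra R H :=
  AlgHom.codRestrict
    ((AlgHom.pi fun V => ((MonoidAlgebra.mapDomainAlgHom R R (comapQuotientMap φ V)).comp
      (proj R (V.comap (φ : G →* H) φ.continuous)))))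
    (completedGroupAlgebra R H) (by
      intro x V W h
      have h1 := x.2 (V.comap (φ : G →* H) φ.continuous) (W.comap (φ : G →* H) φ.continuous)
        (fun g hg => h hg)
      change (transition R h) ((MonoidAlgebra.mapDomainAlgHom R R (comapQuotientMap φ V)) (x.1 _)) =
        (MonoidAlgebra.mapDomainAlgHom R R (comapQuotientMap φ W)) (x.1 _)
      rw [← h1]
      have h2 : (transition R h).comp
          (MonoidAlgebra.mapDomainAlgHom R R (comapQuotientMap φ V)) =
          (MonoidAlgebra.mapDomainAlgHom R R (comapQuotientMap φ W)).comp
          (transition R (U := V.comap (φ : G →* H) φ.continuous)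
            (V := W.comap (φ : G →* H) φ.continuous) (fun g hg => h hg)) := by
        refine algHom_ext_of fun g => ?_
        obtain ⟨g, rfl⟩ := QuotientGroup.mk_surjective g
        simp only [AlgHom.comp_apply, transition, MonoidAlgebra.mapDomainAlgHom_apply,
          MonoidAlgebra.mapDomain_single]
        rfl
      exact DFunLike.congr_fun h2 _)

theorem mapGroup_ofGroup (φ : G →ₜ* H) (g : G) :
    mapGroup R φ (ofGroup R g) = ofGroup R (φ g) := by
  ext V : 2
  exact MonoidAlgebra.mapDomain_single

theorem mapGroup_comp {L : Type*} [CommGroup L] [TopologicalSpace L] (ψ : H →ₜ* L) (φ : G →ₜ* H)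
    (x : completedGroupAlgebra R G) :
    mapGroup R ψ (mapGroup R φ x) = mapGroup R (ψ.comp φ) x := by
  ext V : 2
  have h2 : (MonoidAlgebra.mapDomainAlgHom R R (comapQuotientMap ψ V)).comp
      (MonoidAlgebra.mapDomainAlgHom R R (comapQuotientMap φ (V.comap (ψ : H →* L) ψ.continuous))) =
      MonoidAlgebra.mapDomainAlgHom R R (comapQuotientMap (ψ.comp φ) V) := by
    refine algHom_ext_of fun g => ?_
    obtain ⟨g, rfl⟩ := QuotientGroup.mk_surjective g
    simp only [AlgHom.comp_apply, MonoidAlgebra.mapDomainAlgHom_apply,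
      MonoidAlgebra.mapDomain_single]
    exact (MonoidAlgebra.mapDomain_single (f := comapQuotientMap (ψ.comp φ) V) (a := (g : G ⧸ _))
      (r := (1 : R))).symm
  exact DFunLike.congr_fun h2 _

theorem mapGroup_id (x : completedGroupAlgebra R G) :
    mapGroup R (ContinuousMonoidHom.id G) x = x := by
  ext V : 2
  have h2 : MonoidAlgebra.mapDomainAlgHom R R (comapQuotientMap (ContinuousMonoidHom.id G) V) =
      AlgHom.id R _ := by
    refine algHom_ext_of fun g => ?_
    obtain ⟨g, rfl⟩ := QuotientGroup.mk_surjective g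
    simp only [MonoidAlgebra.mapDomainAlgHom_apply, MonoidAlgebra.mapDomain_single]
    rfl
  exact DFunLike.congr_fun h2 _

variable {K : Type*} [CommRing K] [Algebra R K]

/-- The evaluation of elements of `R[[G]]` at a character `χ : G → Kˣ` with open kernel. -/
def evalChar (R : Type*) [CommRing R] [Algebra R K] (χ : G →* Kˣ) (hχ : IsOpen (χ.ker : Set G)) :
    completedGroupAlgebra R G →ₐ[R] K :=
  (MonoidAlgebra.lift R K (G ⧸ χ.ker) ((Units.coeHom K).comp (QuotientGroup.kerLift χ))).comp
    (proj R ⟨χ.ker, hχ⟩)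

theorem evalChar_ofGroup (χ : G →* Kˣ) (hχ : IsOpen (χ.ker : Set G)) (g : G) :
    evalChar R χ hχ (ofGroup R g) = χ g := by
  change MonoidAlgebra.lift R K (G ⧸ χ.ker) _ (MonoidAlgebra.single (g : G ⧸ χ.ker) 1) = _
  rw [MonoidAlgebra.lift_single]
  simp

/-- The value of `x` at `χ` can be read off from the component of `x` at any open subgroup on which
`χ` is trivial. -/
theorem evalChar_eq_lift (χ : G →* Kˣ) (hχ : IsOpen (χ.ker : Set G)) (U : OpenSubgroup G)
    (hU : (U : Subgroup G) ≤ χ.ker) (x : completedGroupAlgebra R G) :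
    evalChar R χ hχ x = MonoidAlgebra.lift R K (G ⧸ (U : Subgroup G))
      ((Units.coeHom K).comp (QuotientGroup.lift (U : Subgroup G) χ hU)) (x.1 U) := by
  have h1 := x.2 U ⟨χ.ker, hχ⟩ hU
  change MonoidAlgebra.lift R K (G ⧸ χ.ker) _ (x.1 ⟨χ.ker, hχ⟩) = _
  rw [← h1]
  have h2 : (MonoidAlgebra.lift R K (G ⧸ χ.ker)
      ((Units.coeHom K).comp (QuotientGroup.kerLift χ))).comp
      (transition R (U := U) (V := ⟨χ.ker, hχ⟩) hU) = MonoidAlgebra.lift R K (G ⧸ (U : Subgroup G))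
      ((Units.coeHom K).comp (QuotientGroup.lift (U : Subgroup G) χ hU)) := by
    refine algHom_ext_of fun g => ?_
    obtain ⟨g, rfl⟩ := QuotientGroup.mk_surjective g
    simp only [AlgHom.comp_apply, transition, MonoidAlgebra.mapDomainAlgHom_apply,
      MonoidAlgebra.mapDomain_single]
    erw [MonoidAlgebra.lift_single, MonoidAlgebra.lift_single]
    rfl
  exact DFunLike.congr_fun h2 _

theorem isOpen_ker_comp {χ : H →* Kˣ} (hχ : IsOpen (χ.ker : Set H)) (φ : G →ₜ* H) :
    IsOpen ((χ.comp (φ : G →* H)).ker : Set G) :=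
  hχ.preimage φ.continuous

theorem evalChar_mapGroup (χ : H →* Kˣ) (hχ : IsOpen (χ.ker : Set H)) (φ : G →ₜ* H)
    (x : completedGroupAlgebra R G) :
    evalChar R χ hχ (mapGroup R φ x) =
      evalChar R (χ.comp (φ : G →* H)) (isOpen_ker_comp hχ φ) x := by
  have h2 : (MonoidAlgebra.lift R K (H ⧸ χ.ker)
      ((Units.coeHom K).comp (QuotientGroup.kerLift χ))).comp
      (MonoidAlgebra.mapDomainAlgHom R R (comapQuotientMap φ ⟨χ.ker, hχ⟩)) =
      MonoidAlgebra.lift R K (G ⧸ (χ.comp (φ : G →* H)).ker)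
      ((Units.coeHom K).comp (QuotientGroup.kerLift (χ.comp (φ : G →* H)))) := by
    refine algHom_ext_of fun g => ?_
    obtain ⟨g, rfl⟩ := QuotientGroup.mk_surjective g
    simp only [AlgHom.comp_apply, MonoidAlgebra.mapDomainAlgHom_apply,
      MonoidAlgebra.mapDomain_single]
    erw [MonoidAlgebra.lift_single, MonoidAlgebra.lift_single]
    rfl
  exact DFunLike.congr_fun h2 _

end Functoriality

/-! ### The topology of the Iwasawa algebra -/

section Topology

variable {p : ℕ} [Fact p.Prime] {G H : Type*} [CommGroup G] [TopologicalSpace G] [CommGroup H]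
  [TopologicalSpace H]

/-- The coefficients of all components of an element of `ℤ_p[[G]]`. -/
def coeffs (p : ℕ) [Fact p.Prime] (G : Type*) [CommGroup G] [TopologicalSpace G] :
    completedGroupAlgebra ℤ_[p] G →+
      ((Σ U : OpenSubgroup G, G ⧸ (U : Subgroup G)) → ℤ_[p]) where
  toFun x i := (x.1 i.1).coeff i.2
  map_zero' := rfl
  map_add' _ _ := rfl

theorem coeffs_injective : Function.Injective (coeffs p G) := by
  intro x y h
  ext U g
  exact congrFun h ⟨U, g⟩

/-- `ℤ_p[[G]]` carries the topology of convergence of all coefficients; for profinite `G` it makes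
`ℤ_p[[G]]` a compact linearly topologized ring. -/
instance : UniformSpace (completedGroupAlgebra ℤ_[p] G) :=
  UniformSpace.comap (coeffs p G) inferInstance

theorem isUniformInducing_coeffs : IsUniformInducing (coeffs p G) := ⟨rfl⟩

theorem isEmbedding_coeffs : Topology.IsEmbedding (coeffs p G) :=
  ⟨isUniformInducing_coeffs.isInducing, coeffs_injective⟩

instance : IsUniformAddGroup (completedGroupAlgebra ℤ_[p] G) :=
  isUniformInducing_coeffs.isUniformAddGroup _

instance : T2Space (completedGroupAlgebra ℤ_[p] G) := isEmbedding_coeffs.t2Space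

theorem continuous_coeff (U : OpenSubgroup G) (g : G ⧸ (U : Subgroup G)) :
    Continuous fun x : completedGroupAlgebra ℤ_[p] G => (x.1 U).coeff g :=
  (continuous_apply (⟨U, g⟩ : Σ U : OpenSubgroup G, G ⧸ (U : Subgroup G))).comp
    isEmbedding_coeffs.continuous

theorem continuous_of_coeff {X : Type*} [TopologicalSpace X]
    {f : X → completedGroupAlgebra ℤ_[p] G}
    (h : ∀ (U : OpenSubgroup G) (g : G ⧸ (U : Subgroup G)), Continuous fun x => ((f x).1 U).coeff g) :
    Continuous f :=
  isEmbedding_coeffs.continuous_iff.2 (continuous_pi fun i => h i.1 i.2)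

theorem continuous_ofGroup [IsTopologicalGroup G] : Continuous (ofGroup (G := G) ℤ_[p]) := by
  refine continuous_of_coeff fun U g => ?_
  have : DiscreteTopology (G ⧸ (U : Subgroup G)) := QuotientGroup.discreteTopology U.isOpen'
  exact (continuous_of_discreteTopology (f := fun h : G ⧸ (U : Subgroup G) =>
    (MonoidAlgebra.single h (1 : ℤ_[p])).coeff g)).comp QuotientGroup.continuous_mk

/-- The ideal of the elements of `ℤ_p[[G]]` whose image in `ℤ_p[G/U]` is divisible by `p ^ s`. -/
def basicIdeal (p : ℕ) [Fact p.Prime] (G : Type*) [CommGroup G] [TopologicalSpace G]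
    (i : OpenSubgroup G × ℕ) : Ideal (completedGroupAlgebra ℤ_[p] G) :=
  (Ideal.span {(p : MonoidAlgebra ℤ_[p] (G ⧸ (i.1 : Subgroup G))) ^ i.2}).comap (proj ℤ_[p] i.1)

theorem mem_span_pow_iff {A : Type*} [CommGroup A] [Finite A] (s : ℕ)
    (x : MonoidAlgebra ℤ_[p] A) :
    x ∈ Ideal.span {(p : MonoidAlgebra ℤ_[p] A) ^ s} ↔ ∀ a, ‖x.coeff a‖ ≤ (p : ℝ) ^ (-s : ℤ) := by
  have h0 : ∀ (y : MonoidAlgebra ℤ_[p] A), (p : MonoidAlgebra ℤ_[p] A) ^ s * y =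
      ((p : ℤ_[p]) ^ s) • y := fun y => by
    rw [Algebra.smul_def, map_pow, map_natCast]
  simp only [PadicInt.norm_le_pow_iff_mem_span_pow, Ideal.mem_span_singleton]
  constructor
  · rintro ⟨y, rfl⟩ a
    rw [h0]
    exact ⟨y.coeff a, rfl⟩
  · intro h
    choose y hy using h
    refine ⟨MonoidAlgebra.ofCoeff (Finsupp.equivFunOnFinite.symm y), ?_⟩
    rw [h0]
    ext a
    exact hy a

theorem basicIdeal_le {U V : OpenSubgroup G} {s t : ℕ} (h : U ≤ V) (hst : s ≤ t) :
    basicIdeal p G (U, t) ≤ basicIdeal p G (V, s) := by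
  intro x hx
  simp only [basicIdeal, Ideal.mem_comap, Ideal.mem_span_singleton] at hx ⊢
  have h1 : proj ℤ_[p] V x = transition ℤ_[p] h (proj ℤ_[p] U x) := (x.2 U V h).symm
  rw [h1]
  refine (pow_dvd_pow _ hst).trans ?_
  simpa using map_dvd (transition ℤ_[p] h) hx

variable [IsTopologicalGroup G] [CompactSpace G]

instance finite_quotient_openSubgroup (U : OpenSubgroup G) : Finite (G ⧸ (U : Subgroup G)) :=
  Subgroup.quotient_finite_of_isOpen _ U.isOpen'

theorem coeff_mapDomain_eq_sum {A B : Type*} [Fintype A] [DecidableEq B] {R : Type*} [CommRing R]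
    [Monoid A] [Monoid B]
    (φ : A →* B) (x : MonoidAlgebra R A) (b : B) :
    (MonoidAlgebra.mapDomainAlgHom R R φ x).coeff b =
      ∑ a, if φ a = b then x.coeff a else 0 := by
  induction x using MonoidAlgebra.induction_linear with
  | zero => simp
  | add x y hx hy =>
    rw [map_add, MonoidAlgebra.coeff_add, Finsupp.add_apply, hx, hy, ← Finset.sum_add_distrib]
    refine Finset.sum_congr rfl fun a _ => ?_
    split_ifs <;> simp
  | single a r =>
    rw [MonoidAlgebra.mapDomainAlgHom_apply, MonoidAlgebra.mapDomain_single,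
      MonoidAlgebra.coeff_single, Finset.sum_eq_single a]
    · simp [Finsupp.single_apply]
    · intro c _ hc
      simp [hc.symm]
    · simp

theorem continuous_mapGroup (φ : G →ₜ* H) : Continuous (mapGroup ℤ_[p] φ) := by
  classical
  refine continuous_of_coeff fun V h => ?_
  have : Fintype (G ⧸ (V.comap (φ : G →* H) φ.continuous : Subgroup G)) := Fintype.ofFinite _
  have h1 : (fun x => ((mapGroup ℤ_[p] φ x).1 V).coeff h) = fun x =>
      ∑ a, if comapQuotientMap φ V a = h then
        (x.1 (V.comap (φ : G →* H) φ.continuous)).coeff a else 0 := by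
    ext1 x
    exact coeff_mapDomain_eq_sum _ _ _
  rw [h1]
  refine continuous_finsetSum _ fun a _ => ?_
  split_ifs
  · exact continuous_coeff _ _
  · exact continuous_const

instance : IsTopologicalRing (completedGroupAlgebra ℤ_[p] G) where
  continuous_mul := by
    refine continuous_of_coeff fun U g => ?_
    have : Fintype (G ⧸ (U : Subgroup G)) := Fintype.ofFinite _
    have h1 : (fun x : completedGroupAlgebra ℤ_[p] G × completedGroupAlgebra ℤ_[p] G =>
        ((x.1 * x.2).1 U).coeff g) = fun x =>
        ∑ h, (x.1.1 U).coeff h * (x.2.1 U).coeff (h⁻¹ * g) := by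
      ext1 x
      change ((x.1.1 U) * (x.2.1 U)).coeff g = _
      rw [MonoidAlgebra.coeff_mul_apply_left, Finsupp.sum_fintype]
      simp
    rw [h1]
    exact continuous_finsetSum _ fun h _ => ((continuous_coeff U h).comp continuous_fst).mul
      ((continuous_coeff U _).comp continuous_snd)

/-- The compatible families form a closed subset of a product of copies of `ℤ_p`. -/
instance : CompactSpace (completedGroupAlgebra ℤ_[p] G) := by
  classical
  have hft : ∀ U : OpenSubgroup G, Fintype (G ⧸ (U : Subgroup G)) := fun U => Fintype.ofFinite _
  refine Topology.IsClosedEmbedding.compactSpace (f := coeffs p G) ⟨isEmbedding_coeffs, ?_⟩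
  have h1 : Set.range (coeffs p G) = ⋂ (U : OpenSubgroup G) (V : OpenSubgroup G) (h : U ≤ V)
      (g : G ⧸ (V : Subgroup G)),
      {x | ∑ a, (if quotientMap h a = g then x ⟨U, a⟩ else 0) = x ⟨V, g⟩} := by
    ext x
    simp only [Set.mem_range, Set.mem_iInter, Set.mem_ofPred_eq]
    constructor
    · rintro ⟨y, rfl⟩ U V h g
      change _ = (y.1 V).coeff g
      rw [← y.2 U V h]
      exact (coeff_mapDomain_eq_sum (quotientMap h) (y.1 U) g).symm
    · intro h
      refine ⟨⟨fun U => MonoidAlgebra.ofCoeff (Finsupp.equivFunOnFinite.symm fun g => x ⟨U, g⟩),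
        fun U V hUV => ?_⟩, ?_⟩
      · refine MonoidAlgebra.coeff_injective (Finsupp.ext fun g => ?_)
        have h2 := coeff_mapDomain_eq_sum (quotientMap hUV)
          (MonoidAlgebra.ofCoeff (Finsupp.equivFunOnFinite.symm fun g => x ⟨U, g⟩)) g
        exact h2.trans (h U V hUV g)
      · rfl
  rw [h1]
  refine isClosed_iInter fun U => isClosed_iInter fun V => isClosed_iInter fun h =>
    isClosed_iInter fun g => isClosed_eq (continuous_finsetSum _ fun a _ => ?_) (continuous_apply _)
  split_ifs
  · exact continuous_apply _
  · exact continuous_const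

theorem mem_basicIdeal {i : OpenSubgroup G × ℕ} {x : completedGroupAlgebra ℤ_[p] G} :
    x ∈ basicIdeal p G i ↔ ∀ a, ‖(x.1 i.1).coeff a‖ ≤ (p : ℝ) ^ (-i.2 : ℤ) :=
  mem_span_pow_iff _ _

theorem hasBasis_nhds_zero : (nhds (0 : completedGroupAlgebra ℤ_[p] G)).HasBasis (fun _ => True)
    fun i : OpenSubgroup G × ℕ => (basicIdeal p G i : Set (completedGroupAlgebra ℤ_[p] G)) := by
  have hp : (1 : ℝ) < p := by exact_mod_cast (Fact.out : p.Prime).one_lt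
  have hsmall : ∀ ε > (0 : ℝ), ∃ s : ℕ, (p : ℝ) ^ (-s : ℤ) < ε := by
    intro ε hε
    obtain ⟨s, hs⟩ := exists_pow_lt_of_lt_one hε (inv_lt_one_of_one_lt₀ hp)
    exact ⟨s, by rwa [zpow_neg, zpow_natCast, ← inv_pow]⟩
  refine ⟨fun t => ⟨fun ht => ?_, ?_⟩⟩
  · rw [isEmbedding_coeffs.nhds_eq_comap, mem_comap] at ht
    obtain ⟨W, hW, hWt⟩ := ht
    rw [map_zero, nhds_pi, mem_pi] at hW
    obtain ⟨I, hI, S, hS, hSW⟩ := hW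
    suffices ∃ i, (basicIdeal p G i : Set _) ⊆ (coeffs p G) ⁻¹' (I.pi S) by
      obtain ⟨i, hi⟩ := this
      exact ⟨i, trivial, hi.trans ((Set.preimage_mono hSW).trans hWt)⟩
    clear hSW
    induction I, hI using Set.Finite.induction_on with
    | empty => exact ⟨(⊤, 0), by simp⟩
    | insert _ _ ih =>
      rename_i j I hjI hI
      obtain ⟨⟨U, s⟩, hi⟩ := ih
      obtain ⟨ε, hε, hεS⟩ := Metric.mem_nhds_iff.1 (hS j)
      obtain ⟨s', hs'⟩ := hsmall ε hε
      refine ⟨(U ⊓ j.1, max s s'), fun x hx => ?_⟩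
      rw [Set.mem_preimage, Set.insert_pi]
      refine ⟨hεS ?_, hi (basicIdeal_le inf_le_left (le_max_left _ _) hx)⟩
      have h2 := basicIdeal_le inf_le_right (le_max_right _ _) hx
      rw [mem_basicIdeal] at h2
      rw [Metric.mem_ball, dist_eq_norm]
      rw [Pi.zero_apply, sub_zero]
      exact (h2 j.2).trans_lt hs'
  · rintro ⟨⟨U, s⟩, -, h⟩
    refine mem_of_superset ?_ h
    have h3 : (basicIdeal p G (U, s) : Set (completedGroupAlgebra ℤ_[p] G)) =
        ⋂ a : G ⧸ (U : Subgroup G), (fun x : completedGroupAlgebra ℤ_[p] G => (x.1 U).coeff a) ⁻¹'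
          Metric.closedBall 0 ((p : ℝ) ^ (-s : ℤ)) := by
      ext x
      simp [mem_basicIdeal]
    rw [h3, iInter_mem]
    intro a
    refine (continuous_coeff U a).continuousAt.preimage_mem_nhds ?_
    exact Metric.closedBall_mem_nhds _ (by positivity)

instance : IsLinearTopology (completedGroupAlgebra ℤ_[p] G) (completedGroupAlgebra ℤ_[p] G) :=
  IsLinearTopology.mk_of_hasBasis _ hasBasis_nhds_zero

/-- The group algebra `ℤ_p[G]` is dense in `ℤ_p[[G]]`, so a closed subalgebra that contains `G` is
all of `ℤ_p[[G]]`. -/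
theorem eq_top_of_isClosed {S : Subalgebra ℤ_[p] (completedGroupAlgebra ℤ_[p] G)}
    (hS : IsClosed (S : Set (completedGroupAlgebra ℤ_[p] G))) (h : ∀ g, ofGroup ℤ_[p] g ∈ S) :
    S = ⊤ := by
  refine eq_top_iff.2 fun x _ => ?_
  rw [← SetLike.mem_coe, ← hS.closure_eq, mem_closure_iff_nhds]
  intro t ht
  obtain ⟨⟨U, s⟩, -, hi⟩ := ((hasBasis_nhds_zero (p := p) (G := G)).map (x + ·)).mem_iff.1
    (by rwa [map_add_left_nhds_zero])
  have key : ∀ y : MonoidAlgebra ℤ_[p] (G ⧸ (U : Subgroup G)), ∃ z ∈ S, proj ℤ_[p] U z = y := by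
    intro y
    induction y using MonoidAlgebra.induction_on with
    | of g =>
      obtain ⟨γ, rfl⟩ := QuotientGroup.mk_surjective g
      exact ⟨ofGroup ℤ_[p] γ, h γ, rfl⟩
    | add x y hx hy =>
      obtain ⟨a, ha, rfl⟩ := hx
      obtain ⟨b, hb, rfl⟩ := hy
      exact ⟨a + b, add_mem ha hb, map_add _ _ _⟩
    | smul r x hx =>
      obtain ⟨a, ha, rfl⟩ := hx
      exact ⟨r • a, S.smul_mem ha r, map_smul _ _ _⟩
  obtain ⟨z, hz, hzx⟩ := key (proj ℤ_[p] U x)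
  refine ⟨z, hi ⟨z - x, ?_, by simp⟩, hz⟩
  simp [basicIdeal, hzx]

end Topology

/-! ### Power series over the Iwasawa algebra -/

section PowerSeriesPresentation

/-- The group `ℤ_p^d`, written multiplicatively. -/
abbrev FreeProP (p : ℕ) [Fact p.Prime] (d : ℕ) : Type :=
  Multiplicative (Fin d → ℤ_[p])

variable {p : ℕ} [Fact p.Prime] {d : ℕ}

theorem tendsto_pow_prime_pow (x : FreeProP p d) :
    Tendsto (fun n : ℕ => x ^ p ^ n) atTop (nhds 1) := by
  have h1 : Tendsto (fun n : ℕ => (p : ℤ_[p]) ^ n) atTop (nhds 0) := by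
    refine tendsto_pow_atTop_nhds_zero_of_norm_lt_one ?_
    rw [PadicInt.norm_p]
    exact inv_lt_one_of_one_lt₀ (by exact_mod_cast (Fact.out : p.Prime).one_lt)
  have h2 : Tendsto (fun n : ℕ => (p : ℤ_[p]) ^ n • x.toAdd) atTop (nhds 0) := by
    simpa using h1.smul_const x.toAdd
  refine (((continuous_ofAdd (X := Fin d → ℤ_[p])).tendsto 0).comp h2).congr fun n => ?_
  apply Multiplicative.toAdd.injective
  ext i
  simp

theorem prime_dvd_sub_one_pow {R : Type*} [CommRing R] {x : R} {N : ℕ} (hx : x ^ p ^ N = 1) :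
    (p : R) ∣ (x - 1) ^ p ^ N := by
  obtain ⟨r, hr⟩ := exists_add_pow_prime_pow_eq (Fact.out : p.Prime) (x - 1) 1 N
  rw [sub_add_cancel, hx, one_pow] at hr
  exact ⟨-((x - 1) * r), by linear_combination -hr⟩

/-- In `ℤ_p[G/U]` some power of `γ - 1` is divisible by `p`, as some `p`-power of `γ` is `1`. -/
theorem isTopologicallyNilpotent_ofGroup_sub_one {G : Type*} [CommGroup G] [TopologicalSpace G]
    [IsTopologicalGroup G] [CompactSpace G] {γ : G}
    (hγ : Tendsto (fun n : ℕ => γ ^ p ^ n) atTop (nhds 1)) :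
    IsTopologicallyNilpotent (ofGroup ℤ_[p] γ - 1) := by
  refine hasBasis_nhds_zero.tendsto_right_iff.2 fun i _ => ?_
  obtain ⟨U, s⟩ := i
  obtain ⟨N, hN⟩ := (hγ.eventually (U.isOpen'.mem_nhds U.one_mem)).exists
  have h1 : proj ℤ_[p] U (ofGroup ℤ_[p] γ) ^ p ^ N = 1 := by
    rw [← map_pow, ← map_pow]
    change MonoidAlgebra.single ((γ ^ p ^ N : G) : G ⧸ (U : Subgroup G)) 1 = _
    rw [(QuotientGroup.eq_one_iff _).2 hN]
    rfl
  have h2 : (p : MonoidAlgebra ℤ_[p] (G ⧸ (U : Subgroup G))) ∣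
      proj ℤ_[p] U (ofGroup ℤ_[p] γ - 1) ^ p ^ N := by
    rw [map_sub, map_one]
    exact prime_dvd_sub_one_pow h1
  filter_upwards [eventually_ge_atTop (p ^ N * s)] with n hn
  change proj ℤ_[p] U _ ∈ Ideal.span {_}
  rw [Ideal.mem_span_singleton, map_pow]
  refine (pow_dvd_pow_of_dvd h2 s).trans ?_
  rw [← pow_mul]
  exact pow_dvd_pow _ hn

open scoped PowerSeries.WithPiTopology

variable {A : Type*} [CommRing A] [UniformSpace A] [IsUniformAddGroup A] [IsTopologicalRing A]
  [Algebra ℤ_[p] A]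

/-- The homomorphism `A⟦T⟧ → ℤ_p[[G]]` extending `φ : A → ℤ_p[[G]]` that sends `T` to `γ - 1`. -/
def powerSeriesEval (φ : A →ₐ[ℤ_[p]] completedGroupAlgebra ℤ_[p] (FreeProP p d))
    (hφ : Continuous φ) (γ : FreeProP p d) :
    PowerSeries A →+* completedGroupAlgebra ℤ_[p] (FreeProP p d) :=
  PowerSeries.eval₂Hom (φ := (φ : A →+* completedGroupAlgebra ℤ_[p] (FreeProP p d)))
    (show Continuous (φ : A →+* completedGroupAlgebra ℤ_[p] (FreeProP p d)) from hφ)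
    (isTopologicallyNilpotent_ofGroup_sub_one (tendsto_pow_prime_pow γ))

variable (φ : A →ₐ[ℤ_[p]] completedGroupAlgebra ℤ_[p] (FreeProP p d)) (hφ : Continuous φ)
  (γ : FreeProP p d)

theorem powerSeriesEval_C (a : A) : powerSeriesEval φ hφ γ (PowerSeries.C a) = φ a := by
  rw [powerSeriesEval, PowerSeries.coe_eval₂Hom, PowerSeries.eval₂_C]
  rfl

theorem powerSeriesEval_X : powerSeriesEval φ hφ γ PowerSeries.X = ofGroup ℤ_[p] γ - 1 := by
  rw [powerSeriesEval, PowerSeries.coe_eval₂Hom, PowerSeries.eval₂_X]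

theorem continuous_powerSeriesEval : Continuous (powerSeriesEval φ hφ γ) := by
  rw [powerSeriesEval, PowerSeries.coe_eval₂Hom]
  exact PowerSeries.continuous_eval₂
    (show Continuous (φ : A →+* completedGroupAlgebra ℤ_[p] (FreeProP p d)) from hφ)
    (isTopologicallyNilpotent_ofGroup_sub_one (tendsto_pow_prime_pow γ))

/-- The image is a compact subalgebra; it contains the powers of `γ`, hence by density of `ℕ` in `ℤ_p`
the closed subgroup generated by `γ`, and so the group algebra. -/
theorem powerSeriesEval_surjective [CompactSpace A] {H : Type*} [CommGroup H] [TopologicalSpace H]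
    (E : FreeProP p d ≃ₜ* H × Multiplicative ℤ_[p])
    (h : ∀ x : H, ofGroup ℤ_[p] (E.symm (x, 1)) ∈ φ.range) :
    Function.Surjective (powerSeriesEval φ hφ (E.symm (1, Multiplicative.ofAdd 1))) := by
  set γ := E.symm (1, Multiplicative.ofAdd 1) with hγ
  let S : Subalgebra ℤ_[p] (completedGroupAlgebra ℤ_[p] (FreeProP p d)) :=
    { (powerSeriesEval φ hφ γ).range with
      algebraMap_mem' := fun r => ⟨PowerSeries.C (algebraMap _ _ r), by
        rw [powerSeriesEval_C, AlgHom.commutes]⟩ }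
  have hS : IsClosed (S : Set (completedGroupAlgebra ℤ_[p] (FreeProP p d))) := by
    have : CompactSpace (PowerSeries A) :=
      inferInstanceAs (CompactSpace ((Unit →₀ ℕ) → A))
    exact (isCompact_range (continuous_powerSeriesEval φ hφ γ)).isClosed
  have hpow : ∀ t : ℤ_[p], ofGroup ℤ_[p] (E.symm (1, Multiplicative.ofAdd t)) ∈ S := by
    have hcl : IsClosed {t : ℤ_[p] | ofGroup ℤ_[p] (E.symm (1, Multiplicative.ofAdd t)) ∈ S} := by
      refine hS.preimage (continuous_ofGroup.comp (E.symm.continuous.comp ?_))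
      exact (Continuous.prodMk continuous_const continuous_ofAdd)
    intro t
    have hmem : t ∈ closure (Set.range (Nat.cast : ℕ → ℤ_[p])) :=
      PadicInt.denseRange_natCast t
    refine (closure_minimal ?_ hcl) hmem
    rintro _ ⟨n, rfl⟩
    have h2 : E.symm (1, Multiplicative.ofAdd (n : ℤ_[p])) = γ ^ n := by
      rw [hγ, ← map_pow]
      congr 1
      ext1
      · simp
      · apply Multiplicative.toAdd.injective
        simp
    change ofGroup ℤ_[p] _ ∈ S
    rw [h2, map_pow]
    have h3 : ofGroup ℤ_[p] γ ∈ S := ⟨1 + PowerSeries.X, by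
      change powerSeriesEval φ hφ γ _ = _
      rw [map_add, powerSeriesEval_X, map_one]
      ring⟩
    exact pow_mem h3 n
  have htop : S = ⊤ := by
    refine eq_top_of_isClosed hS fun g => ?_
    have h3 : g = E.symm ((E g).1, 1) * E.symm (1, Multiplicative.ofAdd (E g).2.toAdd) := by
      rw [← map_mul]
      apply E.injective
      simp
    rw [h3, map_mul]
    refine mul_mem ?_ (hpow _)
    obtain ⟨a, ha⟩ := h (E g).1
    exact ⟨PowerSeries.C a, (powerSeriesEval_C φ hφ γ a).trans ha⟩
  intro x
  have : x ∈ S := htop ▸ Algebra.mem_top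
  exact this

/-- For a linear form `ℓ` on `ℤ_p^(d+1)` whose `j`-th coefficient is a unit, the isomorphism
`ℤ_p^(d+1) ≅ ℤ_p^d × ℤ_p` that sends `x` to its coordinates other than the `j`-th, and `ℓ(x)`. -/
def splitEquiv (j : Fin (d + 1)) (l : Fin (d + 1) → ℤ_[p]) (u : ℤ_[p]ˣ) (hu : l j = u) :
    FreeProP p (d + 1) ≃ₜ* FreeProP p d × Multiplicative ℤ_[p] where
  toFun x := (Multiplicative.ofAdd fun i => x.toAdd (j.succAbove i),
    Multiplicative.ofAdd (∑ i, l i * x.toAdd i))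
  invFun y := Multiplicative.ofAdd (j.insertNth (α := fun _ => ℤ_[p])
    ((u⁻¹ : ℤ_[p]ˣ) * (y.2.toAdd - ∑ i, l (j.succAbove i) * y.1.toAdd i)) y.1.toAdd)
  left_inv x := by
    apply Multiplicative.toAdd.injective
    funext i
    rw [toAdd_ofAdd]
    refine Fin.succAboveCases j ?_ (fun i => ?_) i
    · rw [Fin.insertNth_apply_same, toAdd_ofAdd, toAdd_ofAdd, Fin.sum_univ_succAbove _ j, hu]
      simp
    · rw [Fin.insertNth_apply_succAbove, toAdd_ofAdd]
  right_inv y := by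
    ext1
    · apply Multiplicative.toAdd.injective
      funext i
      simp
    · apply Multiplicative.toAdd.injective
      rw [toAdd_ofAdd, toAdd_ofAdd, Fin.sum_univ_succAbove _ j, hu]
      simp
  map_mul' x y := by
    ext1
    · rfl
    · apply Multiplicative.toAdd.injective
      simp [mul_add, Finset.sum_add_distrib]
  continuous_toFun := by
    refine Continuous.prodMk (continuous_ofAdd.comp ?_) (continuous_ofAdd.comp ?_)
    · exact continuous_pi fun i => (continuous_apply _).comp continuous_toAdd
    · exact continuous_finsetSum _ fun i _ =>
        continuous_const.mul ((continuous_apply _).comp continuous_toAdd)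
  continuous_invFun := by
    refine continuous_ofAdd.comp (continuous_pi fun i => ?_)
    have h1 : ∀ i, Continuous fun y : FreeProP p d × Multiplicative ℤ_[p] => y.1.toAdd i :=
      fun i => (continuous_apply i).comp (continuous_toAdd.comp continuous_fst)
    refine Fin.succAboveCases j ?_ (fun i => ?_) i
    · simp only [Fin.insertNth_apply_same]
      exact continuous_const.mul ((continuous_toAdd.comp continuous_snd).sub
        (continuous_finsetSum _ fun i _ => continuous_const.mul (h1 _)))
    · simp only [Fin.insertNth_apply_succAbove]
      exact h1 i

/-- The inclusion of the first factor of `ℤ_p^(d+1) ≅ ℤ_p^d × ℤ_p`. -/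
def inclFst (E : FreeProP p (d + 1) ≃ₜ* FreeProP p d × Multiplicative ℤ_[p]) :
    FreeProP p d →ₜ* FreeProP p (d + 1) where
  toFun x := E.symm (x, 1)
  map_one' := map_one E.symm
  map_mul' x y := by rw [← map_mul]; simp
  continuous_toFun := E.symm.continuous.comp (by fun_prop)

/-- A generator of the second factor of `ℤ_p^(d+1) ≅ ℤ_p^d × ℤ_p`. -/
def genSnd (E : FreeProP p (d + 1) ≃ₜ* FreeProP p d × Multiplicative ℤ_[p]) :
    FreeProP p (d + 1) :=
  E.symm (1, Multiplicative.ofAdd 1)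

/-- The homomorphism `ℤ_p[[ℤ_p^d]]⟦T⟧ → ℤ_p[[ℤ_p^(d+1)]]` defined by an isomorphism
`ℤ_p^(d+1) ≅ ℤ_p^d × ℤ_p`: it sends `T` to `γ - 1`, where `γ` generates the second factor. -/
def splitEval (E : FreeProP p (d + 1) ≃ₜ* FreeProP p d × Multiplicative ℤ_[p]) :
    PowerSeries (completedGroupAlgebra ℤ_[p] (FreeProP p d)) →+*
      completedGroupAlgebra ℤ_[p] (FreeProP p (d + 1)) :=
  powerSeriesEval (mapGroup ℤ_[p] (inclFst E)) (continuous_mapGroup _) (genSnd E)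

theorem splitEval_surjective (E : FreeProP p (d + 1) ≃ₜ* FreeProP p d × Multiplicative ℤ_[p]) :
    Function.Surjective (splitEval E) :=
  powerSeriesEval_surjective _ _ E fun x => ⟨ofGroup ℤ_[p] x, mapGroup_ofGroup _ _⟩

instance isNoetherianRing_freeProP (d : ℕ) :
    IsNoetherianRing (completedGroupAlgebra ℤ_[p] (FreeProP p d)) := by
  induction d with
  | zero =>
    have h : Function.Surjective
        (algebraMap ℤ_[p] (completedGroupAlgebra ℤ_[p] (FreeProP p 0))) := by
      have h1 : (Algebra.ofId ℤ_[p] (completedGroupAlgebra ℤ_[p] (FreeProP p 0))).range = ⊤ := by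
        refine eq_top_of_isClosed ?_ fun g => ?_
        · refine (isCompact_range (X := ℤ_[p]) (f := algebraMap ℤ_[p]
            (completedGroupAlgebra ℤ_[p] (FreeProP p 0))) ?_).isClosed
          refine continuous_of_coeff fun U g => ?_
          have : Subsingleton (FreeProP p 0 ⧸ (U : Subgroup (FreeProP p 0))) := inferInstance
          have h2 : ∀ r : ℤ_[p], ((algebraMap ℤ_[p]
              (completedGroupAlgebra ℤ_[p] (FreeProP p 0)) r).1 U).coeff g = r := by
            intro r
            rw [Subsingleton.elim g 1]
            change (MonoidAlgebra.single 1 r).coeff 1 = r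
            simp
          simp only [h2]
          exact continuous_id
        · rw [Subsingleton.elim g 1, map_one]
          exact one_mem _
      exact Set.range_eq_univ.1 (congrArg (SetLike.coe) h1)
    exact isNoetherianRing_of_surjective _ _ _ h
  | succ d ih =>
    exact isNoetherianRing_of_surjective _ _ _
      (splitEval_surjective (splitEquiv 0 (fun _ => 1) 1 rfl))

end PowerSeriesPresentation

/-! ### Zeros of power series over an ultrametric field -/

/-- A power series whose coefficients have norm at most `M`, this bound being attained at some index
`< l`, has fewer than `l` nonzero zeros in the open unit disc: dividing by `T - z` for a zero `z`
preserves the bound and lowers the first index at which it is attained. -/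
theorem card_zeros_lt {K : Type*} [NormedField K] [IsUltrametricDist K] {M : ℝ} (hM : 0 < M)
    (l : ℕ) (a : ℕ → K) (ha : ∀ i, ‖a i‖ ≤ M) (hl : ∃ i < l, ‖a i‖ = M) (S : Finset K)
    (hS : ∀ z ∈ S, z ≠ 0 ∧ ‖z‖ < 1 ∧
      Tendsto (fun n => ∑ i ∈ Finset.range n, a i * z ^ i) atTop (nhds 0)) :
    S.card < l := by
  classical
  induction l generalizing a S with
  | zero => simp at hl
  | succ l ih =>
    rcases S.eq_empty_or_nonempty with rfl | ⟨z, hz⟩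
    · simp
    obtain ⟨hz0, hz1, hzt⟩ := hS z hz
    -- `b` is the sequence of coefficients of the quotient of the series by `T - z`.
    let b : ℕ → K := fun i => -(∑ j ∈ Finset.range (i + 1), a j * z ^ j) / z ^ (i + 1)
    have hb0 : a 0 = -(z * b 0) := by
      simp only [b, zero_add, Finset.sum_range_one, pow_zero, mul_one, pow_one]
      field_simp
    have hbs : ∀ i, a (i + 1) = b i - z * b (i + 1) := by
      intro i
      simp only [b]
      rw [Finset.sum_range_succ _ (i + 1)]
      field_simp
      ring
    have hb : ∀ i, ‖b i‖ ≤ M := by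
      intro i
      have h1 : ∀ n ≥ i + 1, ‖∑ j ∈ Finset.range (i + 1), a j * z ^ j -
          ∑ j ∈ Finset.range n, a j * z ^ j‖ ≤ M * ‖z‖ ^ (i + 1) := by
        intro n hn
        rw [norm_sub_rev, ← Finset.sum_Ico_eq_sub _ hn]
        refine IsUltrametricDist.norm_sum_le_of_forall_le_of_nonneg (by positivity) fun j hj => ?_
        rw [norm_mul, norm_pow]
        exact mul_le_mul (ha j) (pow_le_pow_of_le_one (norm_nonneg _) hz1.le
          (Finset.mem_Ico.1 hj).1) (by positivity) hM.le
      have h2 : ‖∑ j ∈ Finset.range (i + 1), a j * z ^ j‖ ≤ M * ‖z‖ ^ (i + 1) := by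
        have h3 := (tendsto_const_nhds (x := ∑ j ∈ Finset.range (i + 1), a j * z ^ j)).sub hzt
        rw [sub_zero] at h3
        exact le_of_tendsto h3.norm (eventually_atTop.2 ⟨i + 1, h1⟩)
      rw [norm_div, norm_neg, norm_pow]
      exact div_le_of_le_mul₀ (by positivity) hM.le h2
    have hlt : ∀ i, ‖z * b i‖ < M := fun i => by
      rw [norm_mul]
      exact (mul_le_mul_of_nonneg_left (hb i) (norm_nonneg z)).trans_lt
        (mul_lt_of_lt_one_left hM hz1)
    obtain ⟨i, hil, hi⟩ := hl
    have hi0 : i ≠ 0 := by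
      rintro rfl
      have := hlt 0
      rw [hb0, norm_neg] at hi
      exact this.ne hi
    obtain ⟨k, rfl⟩ := Nat.exists_eq_succ_of_ne_zero hi0
    have hbk : ‖b k‖ = M := by
      refine le_antisymm (hb k) (not_lt.1 fun h => ?_)
      have h1 : ‖b k - z * b (k + 1)‖ ≤ max ‖b k‖ ‖z * b (k + 1)‖ := by
        rw [sub_eq_add_neg, ← norm_neg (z * b (k + 1))]
        exact IsUltrametricDist.norm_add_le_max _ _
      rw [← hbs, hi] at h1
      exact absurd h1 (not_le.2 (max_lt h (hlt _)))
    have h3 := ih b hb ⟨k, by omega, hbk⟩ (S.erase z) (fun w hw => by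
      obtain ⟨hw0, hw1, hwt⟩ := hS w (Finset.mem_of_mem_erase hw)
      refine ⟨hw0, hw1, ?_⟩
      have hwz : w - z ≠ 0 := sub_ne_zero.2 (Finset.ne_of_mem_erase hw)
      have h4 : ∀ n, ∑ i ∈ Finset.range n, b i * w ^ i =
          (∑ i ∈ Finset.range (n + 1), a i * w ^ i + z * b n * w ^ n) / (w - z) := by
        intro n
        rw [eq_div_iff hwz]
        induction n with
        | zero => simp [hb0]
        | succ n ih' =>
          rw [Finset.sum_range_succ, add_mul, ih', Finset.sum_range_succ _ (n + 1), hbs]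
          ring
      simp only [h4]
      have h5 : Tendsto (fun n => z * b n * w ^ n) atTop (nhds 0) := by
        refine squeeze_zero_norm (a := fun n => M * ‖w‖ ^ n) (fun n => ?_) ?_
        · rw [norm_mul, norm_pow]
          exact mul_le_mul_of_nonneg_right (hlt n).le (by positivity)
        · simpa using (tendsto_pow_atTop_nhds_zero_of_lt_one (norm_nonneg w) hw1).const_mul M
      have h6 := ((hwt.comp (tendsto_add_atTop_nat 1)).add h5).div_const (w - z)
      simpa using h6)
    rw [Finset.card_erase_of_mem hz] at h3
    omega

/-! ### Roots of unity of `p`-power order -/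

section Cyclotomic

variable (p : ℕ) [Fact p.Prime]

/-- Substituting `X + 1` gives an Eisenstein polynomial over `ℤ_p`. -/
theorem irreducible_cyclotomic_prime_pow (n : ℕ) : Irreducible (cyclotomic (p ^ (n + 1)) ℚ_[p]) := by
  have hp : (Ideal.span {(p : ℤ_[p])}).IsPrime :=
    (Ideal.span_singleton_prime (PadicInt.prime_p.ne_zero)).2 PadicInt.prime_p
  have hE := cyclotomic_prime_pow_comp_X_add_one_isEisensteinAt p n
  have hmap : ((cyclotomic (p ^ (n + 1)) ℤ).comp (X + 1)).map (Int.castRingHom ℤ_[p]) =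
      (cyclotomic (p ^ (n + 1)) ℤ_[p]).comp (X + 1) := by
    rw [Polynomial.map_comp, map_cyclotomic]
    simp
  have hmonic : ((cyclotomic (p ^ (n + 1)) ℤ).comp (X + 1)).Monic := by
    have := (cyclotomic.monic (p ^ (n + 1)) ℤ).comp_X_add_C 1
    rwa [C_1] at this
  have hdeg : 0 < ((cyclotomic (p ^ (n + 1)) ℤ).comp (X + 1)).natDegree := by
    rw [natDegree_comp, natDegree_cyclotomic, ← C_1, natDegree_X_add_C, mul_one]
    exact Nat.totient_pos.2 (pow_pos (Fact.out : p.Prime).pos _)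
  have hE' : ((cyclotomic (p ^ (n + 1)) ℤ_[p]).comp (X + 1)).IsEisensteinAt
      (Ideal.span {(p : ℤ_[p])}) := by
    rw [← hmap]
    refine ⟨?_, fun {i} hi => ?_, ?_⟩
    · rw [(hmonic.map _).leadingCoeff]
      exact fun h => hp.ne_top ((Ideal.eq_top_iff_one _).2 h)
    · rw [hmonic.natDegree_map] at hi
      obtain ⟨c, hc⟩ := Ideal.mem_span_singleton.1 (hE.mem hi)
      rw [coeff_map, hc]
      exact Ideal.mem_span_singleton.2 ⟨(c : ℤ_[p]), by simp⟩
    · have h0 := hE.notMem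
      rw [coeff_map]
      rw [Ideal.span_singleton_pow, Ideal.mem_span_singleton] at h0 ⊢
      intro h
      apply h0
      have := (PadicInt.norm_int_le_pow_iff_dvd (p := p)
        (k := ((cyclotomic (p ^ (n + 1)) ℤ).comp (X + 1)).coeff 0) (n := 2)).1 (by
          rw [PadicInt.norm_le_pow_iff_mem_span_pow, Ideal.mem_span_singleton]
          exact h)
      exact_mod_cast this
  have hirr : Irreducible ((cyclotomic (p ^ (n + 1)) ℤ_[p]).comp (X + 1)) := by
    rw [← hmap] at hE' ⊢
    exact hE'.irreducible hp (hmonic.map _).isPrimitive (by rwa [hmonic.natDegree_map])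
  have hirr' : Irreducible (cyclotomic (p ^ (n + 1)) ℤ_[p]) := by
    refine (MulEquiv.irreducible_iff (algEquivAevalXAddC (1 : ℤ_[p]))).1 ?_
    simpa [comp, aeval_def, algEquivAevalXAddC_apply] using hirr
  have h2 := ((cyclotomic.monic (p ^ (n + 1)) ℤ_[p]).irreducible_iff_irreducible_map_fraction_map
    (K := ℚ_[p])).1 hirr'
  rwa [map_cyclotomic] at h2

/-- The Galois group of `ℚ_p` acts on `p`-power roots of unity through all of `ℤ_p^×`. -/
theorem exists_algEquiv_pow (m u : ℕ) (hu : u.Coprime p) :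
    ∃ σ : AlgebraicClosure ℚ_[p] ≃ₐ[ℚ_[p]] AlgebraicClosure ℚ_[p],
      ∀ x, x ^ p ^ m = 1 → σ x = x ^ u := by
  rcases m with _ | m
  · exact ⟨AlgEquiv.refl, fun x hx => by
      have : x = 1 := by simpa using hx
      simp [this]⟩
  have hpos : 0 < p ^ (m + 1) := pow_pos (Fact.out : p.Prime).pos _
  have : NeZero (p ^ (m + 1)) := ⟨hpos.ne'⟩
  obtain ⟨ω, hω⟩ := HasEnoughRootsOfUnity.exists_primitiveRoot
    (AlgebraicClosure ℚ_[p]) (p ^ (m + 1))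
  have hω' : IsPrimitiveRoot (ω ^ u) (p ^ (m + 1)) := hω.pow_of_coprime u (hu.pow_right _)
  have hirr := irreducible_cyclotomic_prime_pow p m
  have h1 : IsConjRoot ℚ_[p] (ω ^ u) ω := by
    rw [IsConjRoot, ← hω.minpoly_eq_cyclotomic_of_irreducible hirr,
      ← hω'.minpoly_eq_cyclotomic_of_irreducible hirr]
  obtain ⟨σ, hσ⟩ := isConjRoot_iff_exists_algEquiv.1 h1
  refine ⟨σ, fun x hx => ?_⟩
  obtain ⟨i, -, rfl⟩ := hω.eq_pow_of_pow_eq_one hx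
  rw [map_pow, hσ, ← pow_mul, ← pow_mul, mul_comm]

theorem norm_algebraMap_padicInt (r : ℤ_[p]) :
    ‖algebraMap ℤ_[p] (AlgebraicClosure ℚ_[p]) r‖ = ‖r‖ := by
  rw [IsScalarTower.algebraMap_apply ℤ_[p] ℚ_[p] (AlgebraicClosure ℚ_[p]), norm_algebraMap']
  rfl

variable {p}

theorem norm_eq_one_of_pow_eq_one {m : ℕ} {x : AlgebraicClosure ℚ_[p]} (hx : x ^ p ^ m = 1) :
    ‖x‖ = 1 := by
  have h := congrArg norm hx
  rw [norm_pow, norm_one] at h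
  exact (pow_eq_one_iff_of_nonneg (norm_nonneg _) (pow_pos (Fact.out : p.Prime).pos m).ne').1 h

/-- In the ring of integers `p` divides a power of `x - 1`. -/
theorem norm_sub_one_lt_one {m : ℕ} {x : AlgebraicClosure ℚ_[p]} (hx : x ^ p ^ m = 1) :
    ‖x - 1‖ < 1 := by
  let O : Subring (AlgebraicClosure ℚ_[p]) :=
    { carrier := {y | ‖y‖ ≤ 1}
      mul_mem' := fun ha hb => (norm_mul_le _ _).trans (mul_le_one₀ ha (norm_nonneg _) hb)
      one_mem' := norm_one.le
      add_mem' := fun ha hb => (IsUltrametricDist.norm_add_le_max _ _).trans (max_le ha hb)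
      zero_mem' := norm_zero.trans_le zero_le_one
      neg_mem' := fun ha => (norm_neg _).trans_le ha }
  obtain ⟨c, hc⟩ := prime_dvd_sub_one_pow (p := p) (N := m)
    (x := (⟨x, (norm_eq_one_of_pow_eq_one hx).le⟩ : O)) (Subtype.ext hx)
  have h1 : (x - 1) ^ p ^ m = (p : AlgebraicClosure ℚ_[p]) * c := congrArg Subtype.val hc
  have hp : ‖(p : AlgebraicClosure ℚ_[p])‖ < 1 := by
    rw [← map_natCast (algebraMap ℚ_[p] (AlgebraicClosure ℚ_[p])), norm_algebraMap']
    exact Padic.norm_p_lt_one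
  have h2 : ‖x - 1‖ ^ p ^ m < 1 := by
    rw [← norm_pow, h1, norm_mul]
    exact mul_lt_one_of_nonneg_of_lt_one_left (norm_nonneg _) hp c.2
  exact (pow_lt_one_iff_of_nonneg (norm_nonneg _) (pow_pos (Fact.out : p.Prime).pos m).ne').1 h2

end Cyclotomic

/-! ### Zeros of ideals of the Iwasawa algebra -/

section ZeroLocus

variable {p : ℕ} [Fact p.Prime]

theorem coe_pow_eq_one {x : (PadicAlgCl p)ˣ} {m : ℕ} (h : x ^ m = 1) :
    (x : PadicAlgCl p) ^ m = 1 := by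
  simpa using congrArg Units.val h

variable {G H : Type*} [CommGroup G] [TopologicalSpace G] [CommGroup H]
  [TopologicalSpace H]

/-- The characters with open kernel and values in `ℚ̄_p` at which all elements of `J` vanish. -/
def zeroLocus (J : Ideal (completedGroupAlgebra ℤ_[p] G)) : Set (G →* (PadicAlgCl p)ˣ) :=
  {χ | ∃ hχ : IsOpen (χ.ker : Set G), ∀ f ∈ J, evalChar ℤ_[p] χ hχ f = 0}

/-- The elements of the zero locus of `J` that are killed by `p ^ n`. -/
def torsionZeros (J : Ideal (completedGroupAlgebra ℤ_[p] G)) (n : ℕ) :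
    Set (G →* (PadicAlgCl p)ˣ) :=
  {χ | (∀ g, χ g ^ p ^ n = 1) ∧ χ ∈ zeroLocus J}

theorem norm_evalChar_le_one {χ : G →* (PadicAlgCl p)ˣ} {m : ℕ} (h : ∀ g, χ g ^ p ^ m = 1)
    (hχ : IsOpen (χ.ker : Set G)) (x : completedGroupAlgebra ℤ_[p] G) :
    ‖evalChar ℤ_[p] χ hχ x‖ ≤ 1 := by
  change ‖MonoidAlgebra.lift ℤ_[p] (PadicAlgCl p) (G ⧸ χ.ker) _ (x.1 ⟨χ.ker, hχ⟩)‖ ≤ 1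
  generalize x.1 ⟨χ.ker, hχ⟩ = y
  change MonoidAlgebra ℤ_[p] (G ⧸ χ.ker) at y
  induction y using MonoidAlgebra.induction_on with
  | of g =>
    obtain ⟨g, rfl⟩ := QuotientGroup.mk_surjective g
    rw [MonoidAlgebra.of_apply, MonoidAlgebra.lift_single, one_smul]
    exact (norm_eq_one_of_pow_eq_one (coe_pow_eq_one (h g))).le
  | add x y hx hy =>
    rw [map_add]
    exact (IsUltrametricDist.norm_add_le_max _ _).trans (max_le hx hy)
  | smul r x hx =>
    rw [map_smul, Algebra.smul_def, norm_mul, norm_algebraMap_padicInt]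
    exact mul_le_one₀ (PadicInt.norm_le_one r) (norm_nonneg _) hx

/-- If `σ` acts on the values of `χ` as the `u`-th power, then it maps the values of elements of
`ℤ_p[[G]]` at `χ` to their values at `χ ^ u`. -/
theorem evalChar_pow {χ : G →* (PadicAlgCl p)ˣ} (hχ : IsOpen (χ.ker : Set G)) {u : ℕ}
    (hχu : IsOpen ((χ ^ u).ker : Set G)) (σ : PadicAlgCl p ≃ₐ[ℚ_[p]] PadicAlgCl p)
    (hσ : ∀ g, σ (χ g) = (χ g : PadicAlgCl p) ^ u) (x : completedGroupAlgebra ℤ_[p] G) :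
    evalChar ℤ_[p] (χ ^ u) hχu x = σ (evalChar ℤ_[p] χ hχ x) := by
  have hle : χ.ker ≤ (χ ^ u).ker := fun g hg => by
    rw [MonoidHom.mem_ker] at hg ⊢
    rw [MonoidHom.pow_apply, hg, one_pow]
  rw [evalChar_eq_lift (χ ^ u) hχu ⟨χ.ker, hχ⟩ hle, evalChar_eq_lift χ hχ ⟨χ.ker, hχ⟩ le_rfl]
  let σ' : PadicAlgCl p →ₐ[ℤ_[p]] PadicAlgCl p := (σ : PadicAlgCl p →ₐ[ℚ_[p]] PadicAlgCl p).restrictScalars ℤ_[p]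
  have h2 : MonoidAlgebra.lift ℤ_[p] (PadicAlgCl p) (G ⧸ χ.ker)
      ((Units.coeHom _).comp (QuotientGroup.lift χ.ker (χ ^ u) hle)) =
      σ'.comp (MonoidAlgebra.lift ℤ_[p] (PadicAlgCl p) (G ⧸ χ.ker)
      ((Units.coeHom _).comp (QuotientGroup.lift χ.ker χ le_rfl))) := by
    refine algHom_ext_of fun g => ?_
    obtain ⟨g, rfl⟩ := QuotientGroup.mk_surjective g
    rw [AlgHom.comp_apply, MonoidAlgebra.lift_single, MonoidAlgebra.lift_single, one_smul, one_smul]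
    refine Eq.trans ?_ (hσ g).symm
    change (((χ ^ u) g : (PadicAlgCl p)ˣ) : PadicAlgCl p) = _
    rw [MonoidHom.pow_apply, Units.val_pow_eq_pow_val]
  exact DFunLike.congr_fun h2 _

/-- The zero locus is stable under the Galois action. -/
theorem pow_mem_zeroLocus {J : Ideal (completedGroupAlgebra ℤ_[p] G)} {χ : G →* (PadicAlgCl p)ˣ}
    {m : ℕ} (h : ∀ g, χ g ^ p ^ m = 1) (hJ : χ ∈ zeroLocus J) {u : ℕ} (hu : u.Coprime p)
    (hχu : IsOpen ((χ ^ u).ker : Set G)) : χ ^ u ∈ zeroLocus J := by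
  obtain ⟨hχ, hJ⟩ := hJ
  obtain ⟨σ, hσ⟩ := exists_algEquiv_pow p m u hu
  refine ⟨hχu, fun f hf => ?_⟩
  rw [evalChar_pow hχ hχu σ (fun g => hσ _ (coe_pow_eq_one (h g))), hJ f hf, map_zero]

theorem isOpen_ker_of_pow_eq_one {d : ℕ} (e : G ≃ₜ* Multiplicative (Fin d → ℤ_[p]))
    {χ : G →* (PadicAlgCl p)ˣ} {m : ℕ} (h : ∀ g, χ g ^ p ^ m = 1) : IsOpen (χ.ker : Set G) := by
  have : IsTopologicalGroup G := Topology.IsInducing.topologicalGroup e e.toHomeomorph.isInducing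
  refine Subgroup.isOpen_mono (H₁ := (layer e m : Subgroup G)) ?_ (layer e m).isOpen'
  rintro _ ⟨g, rfl⟩
  rw [MonoidHom.mem_ker, powMonoidHom_apply, map_pow, h]

theorem isOpen_ker_freeProP {d : ℕ} {χ : FreeProP p d →* (PadicAlgCl p)ˣ} {m : ℕ}
    (h : ∀ g, χ g ^ p ^ m = 1) : IsOpen (χ.ker : Set (FreeProP p d)) :=
  isOpen_ker_of_pow_eq_one (ContinuousMulEquiv.refl _) h

theorem mem_zeroLocus_map {J : Ideal (completedGroupAlgebra ℤ_[p] G)} {φ : G →ₜ* H}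
    {χ : H →* (PadicAlgCl p)ˣ} (hχ : IsOpen (χ.ker : Set H)) :
    χ ∈ zeroLocus (J.map (mapGroup ℤ_[p] φ)) ↔ χ.comp (φ : G →* H) ∈ zeroLocus J := by
  constructor
  · rintro ⟨_, h⟩
    refine ⟨isOpen_ker_comp hχ φ, fun f hf => ?_⟩
    rw [← evalChar_mapGroup χ hχ]
    exact h _ (Ideal.mem_map_of_mem _ hf)
  · rintro ⟨_, h⟩
    refine ⟨hχ, fun f hf => ?_⟩
    have h1 : J.map (mapGroup ℤ_[p] φ) ≤ RingHom.ker (evalChar ℤ_[p] χ hχ) := by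
      rw [Ideal.map_le_iff_le_comap]
      intro x hx
      rw [Ideal.mem_comap, RingHom.mem_ker, evalChar_mapGroup]
      exact h x hx
    exact h1 hf

end ZeroLocus

/-! ### The ideal of coefficients -/

section Slices

variable {p : ℕ} [Fact p.Prime] {d : ℕ}
  (E : FreeProP p (d + 1) ≃ₜ* FreeProP p d × Multiplicative ℤ_[p])

/-- The restriction of a character to the first factor of `ℤ_p^(d+1) ≅ ℤ_p^d × ℤ_p`. -/
abbrev restrictFst (χ : FreeProP p (d + 1) →* (PadicAlgCl p)ˣ) :
    FreeProP p d →* (PadicAlgCl p)ˣ :=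
  χ.comp (inclFst E : FreeProP p d →* FreeProP p (d + 1))

theorem splitEval_C (a : completedGroupAlgebra ℤ_[p] (FreeProP p d)) :
    splitEval E (PowerSeries.C a) = mapGroup ℤ_[p] (inclFst E) a :=
  powerSeriesEval_C _ (continuous_mapGroup _) _ a

theorem splitEval_X : splitEval E PowerSeries.X = ofGroup ℤ_[p] (genSnd E) - 1 :=
  powerSeriesEval_X _ (continuous_mapGroup _) _

/-- A ring homomorphism from power series to the unit ball of a normed field is automatically
continuous for the `X`-adic topology if it sends `X` into the open unit ball. -/
theorem tendsto_sum_ringHom {A K : Type*} [CommRing A] [NormedField K]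
    (θ : PowerSeries A →+* K) (hθ : ∀ F, ‖θ F‖ ≤ 1) (hX : ‖θ PowerSeries.X‖ < 1)
    (F : PowerSeries A) :
    Tendsto (fun n => ∑ i ∈ Finset.range n,
      θ (PowerSeries.C (PowerSeries.coeff i F)) * θ PowerSeries.X ^ i) atTop (nhds (θ F)) := by
  have htrunc : ∀ n, θ (PowerSeries.trunc n F : Polynomial A) = ∑ i ∈ Finset.range n,
      θ (PowerSeries.C (PowerSeries.coeff i F)) * θ PowerSeries.X ^ i := by
    intro n
    induction n with
    | zero => simp
    | succ n ih =>
      rw [PowerSeries.trunc_succ, Polynomial.coe_add, map_add, ih, Finset.sum_range_succ,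
        Polynomial.coe_monomial, PowerSeries.monomial_eq_C_mul_X_pow, map_mul, map_pow]
  have key : ∀ n, θ F - ∑ i ∈ Finset.range n,
      θ (PowerSeries.C (PowerSeries.coeff i F)) * θ PowerSeries.X ^ i =
        θ PowerSeries.X ^ n * θ (PowerSeries.mk fun i => PowerSeries.coeff (i + n) F) := by
    intro n
    have h1 := congrArg θ (PowerSeries.eq_X_pow_mul_shift_add_trunc n F)
    rw [map_add, map_mul, map_pow, htrunc] at h1
    exact sub_eq_of_eq_add h1
  rw [tendsto_iff_norm_sub_tendsto_zero]
  refine squeeze_zero (g := fun n => ‖θ PowerSeries.X‖ ^ n) (fun _ => norm_nonneg _) (fun n => ?_)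
    (tendsto_pow_atTop_nhds_zero_of_lt_one (norm_nonneg _) hX)
  rw [norm_sub_rev, key, norm_mul, norm_pow]
  exact mul_le_of_le_one_right (by positivity) (hθ _)

/-- The value of a power series over `ℤ_p[[ℤ_p^d]]` at a character is the sum of the series obtained
by evaluating its coefficients. -/
theorem tendsto_evalChar_splitEval {χ : FreeProP p (d + 1) →* (PadicAlgCl p)ˣ} {m : ℕ}
    (h : ∀ g, χ g ^ p ^ m = 1) (hχ : IsOpen (χ.ker : Set (FreeProP p (d + 1))))
    (F : PowerSeries (completedGroupAlgebra ℤ_[p] (FreeProP p d))) :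
    Tendsto (fun n => ∑ i ∈ Finset.range n,
      evalChar ℤ_[p] (restrictFst E χ) (isOpen_ker_comp hχ _) (PowerSeries.coeff i F) *
        ((χ (genSnd E) : PadicAlgCl p) - 1) ^ i) atTop
      (nhds (evalChar ℤ_[p] χ hχ (splitEval E F))) := by
  have h1 := tendsto_sum_ringHom ((evalChar ℤ_[p] χ hχ).toRingHom.comp (splitEval E))
    (fun x => norm_evalChar_le_one h hχ _)
  simp only [RingHom.comp_apply, splitEval_X, splitEval_C, AlgHom.toRingHom_eq_coe,
    RingHom.coe_coe, map_sub, evalChar_ofGroup, map_one, evalChar_mapGroup] at h1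
  exact h1 (norm_sub_one_lt_one (coe_pow_eq_one (h _))) F

theorem mem_map_C_of_coeff_mem {A : Type*} [CommRing A] (T : Finset A) (F : PowerSeries A)
    (hF : ∀ i, PowerSeries.coeff i F ∈ Ideal.span (T : Set A)) :
    F ∈ (Ideal.span (T : Set A)).map (PowerSeries.C (R := A)) := by
  have h1 : ∀ i, ∃ r : A → A, ∑ a ∈ T, r a * a = PowerSeries.coeff i F := fun i => by
    obtain ⟨r, -, hr⟩ := Submodule.mem_span_finset.1 (hF i)
    exact ⟨r, hr⟩
  choose r hr using h1
  have h2 : F = ∑ a ∈ T, PowerSeries.mk (fun i => r i a) * PowerSeries.C a := by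
    ext i
    rw [map_sum, ← hr]
    exact Finset.sum_congr rfl fun a _ => by rw [PowerSeries.coeff_mul_C, PowerSeries.coeff_mk]
  rw [h2]
  exact Ideal.sum_mem _ fun a ha => Ideal.mul_mem_left _ _
    (Ideal.mem_map_of_mem _ (Ideal.subset_span ha))

/-- The coefficients of the power series representing the elements of `J` generate an ideal `J'`
that contains `J` after extension. By noetherianity, finitely many indices of coefficients suffice
to generate `J'`, which bounds uniformly the number of zeros of the specializations of these power
series; a character of large order in the direction of the second factor has more Galois conjugates
with the same restriction to the first factor than this bound. -/
theorem exists_coeff_ideal (J : Ideal (completedGroupAlgebra ℤ_[p] (FreeProP p (d + 1)))) :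
    ∃ (J' : Ideal (completedGroupAlgebra ℤ_[p] (FreeProP p d))) (k : ℕ),
      J ≤ J'.map (mapGroup ℤ_[p] (inclFst E)) ∧
      ∀ (m : ℕ) (χ : FreeProP p (d + 1) →* (PadicAlgCl p)ˣ), k < m → (∀ g, χ g ^ p ^ m = 1) →
        χ ∈ zeroLocus J → IsPrimitiveRoot (χ (genSnd E) : PadicAlgCl p) (p ^ m) →
        (∀ g, restrictFst E χ g ^ p ^ (m - k) = 1) →
        restrictFst E χ ∈ zeroLocus J' := by
  classical
  have hp : 1 < p := (Fact.out : p.Prime).one_lt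
  let S : Set (completedGroupAlgebra ℤ_[p] (FreeProP p d)) :=
    {a | ∃ F, splitEval E F ∈ J ∧ ∃ i, PowerSeries.coeff i F = a}
  obtain ⟨T, hTS, hT⟩ := (Submodule.fg_span_iff_fg_span_finset_subset S).1
    ((isNoetherianRing_iff_ideal_fg _).1 (isNoetherianRing_freeProP d) (Ideal.span S))
  change Ideal.span S = Ideal.span (T : Set _) at hT
  have hTS' : ∀ a : T, ∃ F, splitEval E F ∈ J ∧ ∃ i, PowerSeries.coeff i F = a := fun a => hTS a.2
  choose F hFJ idx hidx using hTS'
  let l := ∑ a, (idx a + 1)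
  have hl : ∀ a, idx a < l := fun a => (Nat.lt_succ_self _).trans_le
    (Finset.single_le_sum (f := fun a => idx a + 1) (fun _ _ => Nat.zero_le _) (Finset.mem_univ a))
  refine ⟨Ideal.span S, l, fun f hf => ?_, fun m χ hlm hχm hχJ hprim hres => ?_⟩
  · obtain ⟨F, rfl⟩ := splitEval_surjective E f
    have h1 : F ∈ (Ideal.span (T : Set _)).map PowerSeries.C := by
      refine mem_map_C_of_coeff_mem T F fun i => ?_
      rw [← hT]
      exact Ideal.subset_span ⟨F, hf, i, rfl⟩
    have h2 := Ideal.mem_map_of_mem (splitEval E) h1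
    rw [Ideal.map_map, ← hT] at h2
    have h3 : (splitEval E).comp PowerSeries.C =
        (mapGroup ℤ_[p] (inclFst E) : _ →+* _) := by
      ext1 a
      exact splitEval_C E a
    rw [h3] at h2
    exact h2
  · have hχ : IsOpen (χ.ker : Set (FreeProP p (d + 1))) := hχJ.1
    have hb := isOpen_ker_comp hχ (inclFst E)
    set b := restrictFst E χ with hbdef
    have hbm : ∀ g, b g ^ p ^ m = 1 := fun g => hχm _
    -- it suffices to show that the generators in `T` vanish at `b`
    suffices hzero : ∀ a ∈ T, evalChar ℤ_[p] b hb a = 0 by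
      refine ⟨hb, fun f hf => ?_⟩
      have h1 : Ideal.span S ≤ RingHom.ker (evalChar ℤ_[p] b hb) := by
        rw [hT, Ideal.span_le]
        exact fun a ha => hzero a ha
      exact h1 hf
    by_contra hne
    push Not at hne
    obtain ⟨a₁, ha₁, hne⟩ := hne
    obtain ⟨a₀, ha₀, hmax⟩ := T.exists_max_image (fun a => ‖evalChar ℤ_[p] b hb a‖) ⟨a₁, ha₁⟩
    have hM : 0 < ‖evalChar ℤ_[p] b hb a₀‖ := (norm_pos_iff.2 hne).trans_le (hmax a₁ ha₁)
    have hall : ∀ a ∈ Ideal.span S, ‖evalChar ℤ_[p] b hb a‖ ≤ ‖evalChar ℤ_[p] b hb a₀‖ := by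
      intro a ha
      rw [hT] at ha
      induction ha using Submodule.span_induction with
      | mem x hx => exact hmax x hx
      | zero => simp
      | add x y _ _ hx hy =>
        rw [map_add]
        exact (IsUltrametricDist.norm_add_le_max _ _).trans (max_le hx hy)
      | smul r x _ hx =>
        rw [smul_eq_mul, map_mul, norm_mul]
        exact (mul_le_of_le_one_left (norm_nonneg _) (norm_evalChar_le_one hbm hb r)).trans hx
    set ω : PadicAlgCl p := Units.val (χ (genSnd E)) with hω
    -- The conjugates `χ ^ u t`, `t < p ^ l`, have the same restriction `b`, since `b` is killed by
    -- `p ^ (m - l)`.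
    let u : ℕ → ℕ := fun t => 1 + p ^ (m - l) * t
    have hu : ∀ t, (u t).Coprime p := by
      intro t
      have h1 : p ∣ p ^ (m - l) * t := (dvd_pow_self p (by omega)).mul_right t
      obtain ⟨c, hc⟩ := h1
      simp only [u, hc]
      simp
    have hlt : ∀ t ∈ Finset.range (p ^ l), u t < p ^ m := by
      intro t ht
      have h1 : p ^ (m - l) * (t + 1) ≤ p ^ m := by
        calc p ^ (m - l) * (t + 1) ≤ p ^ (m - l) * p ^ l :=
              Nat.mul_le_mul_left _ (Finset.mem_range.1 ht)
          _ = p ^ m := by rw [← pow_add, Nat.sub_add_cancel hlm.le]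
      have h2 : 1 < p ^ (m - l) := Nat.one_lt_pow (by omega) hp
      simp only [u]
      rw [mul_add] at h1
      omega
    have hinj : Set.InjOn (fun t => ω ^ u t - 1) (Finset.range (p ^ l)) := by
      intro t ht t' ht' htt
      have h1 := hprim.pow_inj (hlt t ht) (hlt t' ht') (sub_left_injective htt)
      have h2 : 0 < p ^ (m - l) := pow_pos (by omega) _
      exact Nat.eq_of_mul_eq_mul_left h2 (Nat.add_left_cancel h1)
    have hcard := card_zeros_lt hM l
      (fun i => evalChar ℤ_[p] b hb (PowerSeries.coeff i (F ⟨a₀, ha₀⟩)))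
      (fun i => hall _ (Ideal.subset_span ⟨_, hFJ ⟨a₀, ha₀⟩, i, rfl⟩))
      ⟨idx ⟨a₀, ha₀⟩, hl _, by rw [hidx]⟩
      ((Finset.range (p ^ l)).image fun t => ω ^ u t - 1) (by
        intro z hz
        obtain ⟨t, ht, rfl⟩ := Finset.mem_image.1 hz
        have hχu : ∀ g, (χ ^ u t) g ^ p ^ m = 1 := fun g => by
          rw [MonoidHom.pow_apply, pow_right_comm, hχm, one_pow]
        have hop : IsOpen ((χ ^ u t).ker : Set (FreeProP p (d + 1))) := isOpen_ker_freeProP hχu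
        have hval : ((χ ^ u t) (genSnd E) : PadicAlgCl p) = ω ^ u t := by
          rw [MonoidHom.pow_apply, Units.val_pow_eq_pow_val]
        have hcomp : restrictFst E (χ ^ u t) = b := by
          refine MonoidHom.ext fun x => ?_
          change (χ ^ u t) (inclFst E x) = χ (inclFst E x)
          have h1 : χ (inclFst E x) ^ p ^ (m - l) = 1 := hres x
          rw [MonoidHom.pow_apply, pow_add, pow_mul, h1, one_pow, pow_one, mul_one]
        refine ⟨?_, ?_, ?_⟩
        · refine sub_ne_zero.2 fun h1 => ?_
          have h2 : 1 < p ^ m := Nat.one_lt_pow (by omega) hp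
          have h3 := hprim.pow_inj (hlt t ht) (by omega) (h1.trans (pow_zero ω).symm)
          simp [u] at h3
        · rw [← hval]
          exact norm_sub_one_lt_one (coe_pow_eq_one (hχu _))
        · have h1 := tendsto_evalChar_splitEval E hχu hop (F ⟨a₀, ha₀⟩)
          obtain ⟨_, h2⟩ := pow_mem_zeroLocus hχm hχJ (hu t) hop
          rw [h2 _ (hFJ ⟨a₀, ha₀⟩), hval] at h1
          simpa only [hcomp] using h1)
    rw [Finset.card_image_of_injOn hinj, Finset.card_range] at hcard
    exact absurd hcard (not_lt.2 (Nat.lt_pow_self hp).le)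

end Slices

/-! ### Simple elements -/

section Simple

variable {p : ℕ} [Fact p.Prime] {d : ℕ}

theorem mapGroup_simpleElement {G H : Type*} [CommGroup G] [TopologicalSpace G] [CommGroup H]
    [TopologicalSpace H] (φ : G →ₜ* H) (γ : G) (ζ : AlgebraicClosure ℚ_[p]) :
    mapGroup ℤ_[p] φ (simpleElement p γ ζ) = simpleElement p (φ γ) ζ := by
  rw [simpleElement, simpleElement, ← Polynomial.aeval_algHom_apply, mapGroup_ofGroup]

theorem evalChar_simpleElement {G : Type*} [CommGroup G] [TopologicalSpace G]
    (χ : G →* (PadicAlgCl p)ˣ) (hχ : IsOpen (χ.ker : Set G)) (γ : G)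
    (ζ : AlgebraicClosure ℚ_[p]) :
    evalChar ℤ_[p] χ hχ (simpleElement p γ ζ) =
      aeval (χ γ : PadicAlgCl p) (minpoly ℤ_[p] ζ) := by
  rw [simpleElement, ← Polynomial.aeval_algHom_apply, evalChar_ofGroup]

theorem not_exists_pow_eq_genSnd
    (E : FreeProP p (d + 1) ≃ₜ* FreeProP p d × Multiplicative ℤ_[p]) :
    ¬ ∃ δ, δ ^ p = genSnd E := by
  rintro ⟨δ, hδ⟩
  have h1 := congrArg (fun x => (E x).2.toAdd) hδ
  simp only [genSnd, map_pow, ContinuousMulEquiv.apply_symm_apply, toAdd_ofAdd, Prod.pow_snd,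
    toAdd_pow, nsmul_eq_mul] at h1
  exact PadicInt.prime_p.not_isUnit (IsUnit.of_mul_eq_one _ h1)

theorem exists_pow_eq_of_inclFst
    (E : FreeProP p (d + 1) ≃ₜ* FreeProP p d × Multiplicative ℤ_[p]) {γ : FreeProP p d}
    (h : ∃ δ, δ ^ p = inclFst E γ) : ∃ δ, δ ^ p = γ := by
  obtain ⟨δ, hδ⟩ := h
  refine ⟨(E δ).1, ?_⟩
  have h1 : (E (δ ^ p)).1 = (E (E.symm (γ, 1))).1 := congrArg (fun x => (E x).1) hδ
  rwa [map_pow, Prod.pow_fst, ContinuousMulEquiv.apply_symm_apply] at h1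

theorem isSimpleElement_mapGroup_inclFst
    (E : FreeProP p (d + 1) ≃ₜ* FreeProP p d × Multiplicative ℤ_[p])
    {s : completedGroupAlgebra ℤ_[p] (FreeProP p d)} (hs : IsSimpleElement p s) :
    IsSimpleElement p (mapGroup ℤ_[p] (inclFst E) s) := by
  obtain ⟨γ, ζ, hγ, hζ, rfl⟩ := hs
  exact ⟨inclFst E γ, ζ, fun h => hγ (exists_pow_eq_of_inclFst E h), hζ,
    mapGroup_simpleElement _ _ _⟩

theorem continuous_algebraMap (G : Type*) [CommGroup G] [TopologicalSpace G] :
    Continuous (Algebra.ofId ℤ_[p] (completedGroupAlgebra ℤ_[p] G)) := by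
  refine continuous_of_coeff fun U g => ?_
  change Continuous fun r : ℤ_[p] => (MonoidAlgebra.single (1 : G ⧸ (U : Subgroup G)) r).coeff g
  by_cases hg : 1 = g
  · subst hg
    simp only [MonoidAlgebra.coeff_single, Finsupp.single_eq_same]
    exact continuous_id
  · have h : ∀ r : ℤ_[p], (MonoidAlgebra.single (1 : G ⧸ (U : Subgroup G)) r).coeff g = 0 :=
      fun r => by rw [MonoidAlgebra.coeff_single, Finsupp.single_eq_of_ne (Ne.symm hg)]
    simp only [h]
    exact continuous_const

open scoped PowerSeries.WithPiTopology in
theorem powerSeriesEval_coe (γ : FreeProP p d) (Q : ℤ_[p][X]) :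
    powerSeriesEval (Algebra.ofId ℤ_[p] _) (continuous_algebraMap _) γ (Q : PowerSeries ℤ_[p]) =
      aeval (ofGroup ℤ_[p] γ - 1) Q := by
  induction Q using Polynomial.induction_on' with
  | add P Q hP hQ => rw [Polynomial.coe_add, map_add, map_add, hP, hQ]
  | monomial i a =>
    rw [Polynomial.coe_monomial, PowerSeries.monomial_eq_C_mul_X_pow, map_mul, map_pow,
      powerSeriesEval_C, powerSeriesEval_X, Polynomial.aeval_monomial]
    rfl

/-- Weierstrass division by a monic polynomial `P`: as the reduction of `P` has a nonzero coefficient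
of index `deg P`, its order is at most `deg P`. -/
theorem exists_division_by_monic {P : ℤ_[p][X]} (hP : P.Monic) (F : PowerSeries ℤ_[p]) :
    ∃ (q : PowerSeries ℤ_[p]) (r : ℤ_[p][X]), F = P * q + r ∧ r.degree < P.natDegree := by
  have hcoeff : PowerSeries.coeff P.natDegree ((P : PowerSeries ℤ_[p]).map
      (IsLocalRing.residue ℤ_[p])) ≠ 0 := by
    rw [PowerSeries.coeff_map, Polynomial.coeff_coe, hP.coeff_natDegree, map_one]
    exact one_ne_zero
  have hne : (P : PowerSeries ℤ_[p]).map (IsLocalRing.residue ℤ_[p]) ≠ 0 := fun h => by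
    rw [h] at hcoeff
    exact hcoeff (map_zero _)
  obtain ⟨q, r, hr, hF⟩ := PowerSeries.exists_isWeierstrassDivision F hne
  refine ⟨q, r, hF, hr.trans_le ?_⟩
  have h1 := PowerSeries.order_le _ hcoeff
  exact_mod_cast ENat.toNat_le_of_le_natCast h1

theorem eq_zero_of_aeval_sub_one {ζ : PadicAlgCl p} (hint : IsIntegral ℤ_[p] ζ) {r : ℤ_[p][X]}
    (hr : r.degree < (minpoly ℤ_[p] ζ).natDegree) (h : aeval (ζ - 1) r = 0) : r = 0 := by
  have h2 : aeval ζ (r.comp (X - C 1)) = 0 := by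
    rw [aeval_comp]
    simpa using h
  have h3 : r.comp (X - C 1) = 0 := by
    by_contra hr1
    have : Module.IsTorsionFree ℤ_[p] (PadicAlgCl p) :=
      Module.IsTorsionFree.trans_faithfulSMul ℤ_[p] ℚ_[p] _
    have h4 := minpoly.IsIntegrallyClosed.degree_le_of_ne_zero hr1 h2
    have h5 : (r.comp (X - C 1)).degree = r.degree := by
      have hr2 : r ≠ 0 := by
        rintro rfl
        simp at hr1
      rw [degree_eq_natDegree hr1, degree_eq_natDegree hr2, natDegree_comp, natDegree_X_sub_C,
        mul_one]
    rw [h5, degree_eq_natDegree (minpoly.ne_zero hint)] at h4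
    exact absurd hr (not_lt.2 h4)
  have h6 := congrArg (fun Q => Q.comp (X + C 1)) h3
  simpa [comp_assoc] using h6

open scoped PowerSeries.WithPiTopology in
/-- For `d = 1`, an ideal that vanishes at a character of finite order is contained in the ideal
generated by a simple element: divide the power series representing its elements by the minimal
polynomial of the value of the character at a generator. -/
theorem exists_isSimpleElement_of_mem_zeroLocus
    (J : Ideal (completedGroupAlgebra ℤ_[p] (FreeProP p 1))) {n : ℕ}
    {χ : FreeProP p 1 →* (PadicAlgCl p)ˣ} (hχ : χ ∈ torsionZeros J n) :
    ∃ s, IsSimpleElement p s ∧ J ≤ Ideal.span {s} := by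
  obtain ⟨htor, hop, hJ⟩ := hχ
  let E : FreeProP p 1 ≃ₜ* FreeProP p 0 × Multiplicative ℤ_[p] :=
    splitEquiv 0 (fun _ => 1) 1 rfl
  set γ := genSnd E with hγ
  set ζ : PadicAlgCl p := Units.val (χ γ) with hζ
  have hroot : IsPPowerRootOfUnity p ζ := ⟨n, coe_pow_eq_one (htor γ)⟩
  have hint := isIntegral_of_isPPowerRootOfUnity p hroot
  refine ⟨simpleElement p γ ζ, ⟨γ, ζ, not_exists_pow_eq_genSnd E, hroot, rfl⟩, fun f hf => ?_⟩
  obtain ⟨F, rfl⟩ := powerSeriesEval_surjective _ (continuous_algebraMap _) E (fun x => by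
    rw [Subsingleton.elim x 1, ← Prod.one_eq_mk, map_one, map_one]
    exact one_mem _) f
  change powerSeriesEval _ (continuous_algebraMap _) γ F ∈ J at hf
  change powerSeriesEval _ (continuous_algebraMap _) γ F ∈ _
  obtain ⟨q, r, hF, hr⟩ := exists_division_by_monic ((minpoly.monic hint).comp_X_add_C 1) F
  rw [natDegree_comp, natDegree_X_add_C, mul_one] at hr
  have hPs : aeval (ofGroup ℤ_[p] γ - 1) ((minpoly ℤ_[p] ζ).comp (X + C 1)) =
      simpleElement p γ ζ := by
    rw [aeval_comp, simpleElement]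
    simp
  rw [hF, map_add, map_mul, powerSeriesEval_coe, powerSeriesEval_coe, hPs] at hf ⊢
  have hr0 : r = 0 := by
    refine eq_zero_of_aeval_sub_one hint hr ?_
    have h1 := hJ _ hf
    rwa [map_add, map_mul, evalChar_simpleElement, minpoly.aeval, zero_mul, zero_add,
      ← Polynomial.aeval_algHom_apply, map_sub, evalChar_ofGroup, map_one] at h1
  rw [hr0, map_zero, add_zero]
  exact Ideal.mul_mem_right _ _ (Ideal.mem_span_singleton_self _)

end Simple

/-! ### Characters of finite order of `ℤ_p^d` -/

section Characters

variable {p : ℕ} [Fact p.Prime] {d : ℕ}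

theorem exists_eq_prod_mul_pow (m : ℕ) (g : FreeProP p d) :
    ∃ (n : Fin d → ℕ) (h : FreeProP p d),
      g = (∏ i, Multiplicative.ofAdd (Pi.single i (1 : ℤ_[p])) ^ n i) * h ^ p ^ m := by
  have h1 : ∀ x : ℤ_[p], ∃ (n : ℕ) (c : ℤ_[p]), x = n + p ^ m * c := fun x => by
    obtain ⟨c, hc⟩ := Ideal.mem_span_singleton.1 (PadicInt.appr_spec m x)
    exact ⟨x.appr m, c, by rw [← hc]; ring⟩
  choose n c hnc using fun i => h1 (g.toAdd i)
  refine ⟨n, Multiplicative.ofAdd c, ?_⟩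
  apply Multiplicative.toAdd.injective
  funext j
  rw [toAdd_mul, toAdd_prod, toAdd_pow, toAdd_ofAdd, Pi.add_apply, Finset.sum_apply,
    Finset.sum_eq_single j]
  · rw [hnc j]
    simp
  · intro i _ hij
    simp [hij.symm]
  · simp

/-- A character of `p`-power order is determined by its values on the standard basis. -/
theorem char_ext {χ ψ : FreeProP p d →* (PadicAlgCl p)ˣ} {m : ℕ} (hχ : ∀ g, χ g ^ p ^ m = 1)
    (hψ : ∀ g, ψ g ^ p ^ m = 1) (h : ∀ i, χ (Multiplicative.ofAdd (Pi.single i 1)) =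
      ψ (Multiplicative.ofAdd (Pi.single i 1))) : χ = ψ := by
  refine MonoidHom.ext fun g => ?_
  obtain ⟨n, c, rfl⟩ := exists_eq_prod_mul_pow m g
  rw [map_mul, map_mul, map_pow, map_pow, hχ, hψ, map_prod, map_prod]
  simp only [map_pow, h]

theorem finite_setOf_pow_eq_one (m : ℕ) : {x : (PadicAlgCl p)ˣ | x ^ p ^ m = 1}.Finite := by
  have : NeZero (p ^ m) := ⟨(pow_pos (Fact.out : p.Prime).pos m).ne'⟩
  have : Finite (rootsOfUnity (p ^ m) (PadicAlgCl p)) := inferInstance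
  exact Set.finite_coe_iff.1 this

theorem ncard_setOf_pow_eq_one (m : ℕ) : {x : (PadicAlgCl p)ˣ | x ^ p ^ m = 1}.ncard = p ^ m := by
  have : NeZero (p ^ m) := ⟨(pow_pos (Fact.out : p.Prime).pos m).ne'⟩
  exact HasEnoughRootsOfUnity.natCard_rootsOfUnity (PadicAlgCl p) (p ^ m)

theorem finite_torsionChars (m : ℕ) :
    {χ : FreeProP p d →* (PadicAlgCl p)ˣ | ∀ g, χ g ^ p ^ m = 1}.Finite := by
  refine Set.Finite.of_injOn
    (f := fun χ (i : Fin d) => χ (Multiplicative.ofAdd (Pi.single i (1 : ℤ_[p]))))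
    (t := Set.pi Set.univ fun _ => {x : (PadicAlgCl p)ˣ | x ^ p ^ m = 1}) ?_ ?_
    (Set.Finite.pi fun _ => finite_setOf_pow_eq_one m)
  · exact fun χ hχ i _ => hχ _
  · exact fun χ hχ ψ hψ h => char_ext hχ hψ fun i => congrFun h i

/-- The character `x ↦ ω ^ x` of `ℤ_p` defined by a root of unity `ω` with `ω ^ (p ^ m) = 1`. -/
def zpowChar {M : Type*} [CommGroup M] {m : ℕ} (ω : M) (hω : ω ^ p ^ m = 1) :
    Multiplicative ℤ_[p] →* M where
  toFun x := ω ^ (PadicInt.toZModPow m x.toAdd).val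
  map_one' := by simp
  map_mul' x y := by
    have : NeZero (p ^ m) := ⟨(pow_pos (Fact.out : p.Prime).pos m).ne'⟩
    rw [toAdd_mul, map_add, ZMod.val_add, ← pow_add, ← pow_mod_orderOf,
      Nat.mod_mod_of_dvd _ (orderOf_dvd_of_pow_eq_one hω), pow_mod_orderOf]

theorem zpowChar_natCast {M : Type*} [CommGroup M] {m : ℕ} (ω : M) (hω : ω ^ p ^ m = 1) (n : ℕ) :
    zpowChar ω hω (Multiplicative.ofAdd (n : ℤ_[p])) = ω ^ n := by
  change ω ^ (PadicInt.toZModPow m (n : ℤ_[p])).val = _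
  rw [map_natCast, ZMod.val_natCast, ← pow_mod_orderOf,
      Nat.mod_mod_of_dvd _ (orderOf_dvd_of_pow_eq_one hω), pow_mod_orderOf]

/-- The homomorphism `ℤ_p^d → ℤ_p` with coefficients `l`. -/
def linForm (l : Fin d → ℤ_[p]) : FreeProP p d →* Multiplicative ℤ_[p] where
  toFun x := Multiplicative.ofAdd (∑ i, l i * x.toAdd i)
  map_one' := by simp
  map_mul' x y := by
    apply Multiplicative.toAdd.injective
    simp [mul_add, Finset.sum_add_distrib]

theorem dvd_linForm_sub {l l' : Fin d → ℤ_[p]} {c : ℤ_[p]} (h : ∀ i, c ∣ l i - l' i)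
    (g : FreeProP p d) : c ∣ (linForm l g).toAdd - (linForm l' g).toAdd := by
  change c ∣ (∑ i, l i * g.toAdd i) - ∑ i, l' i * g.toAdd i
  rw [← Finset.sum_sub_distrib]
  refine Finset.dvd_sum fun i _ => ?_
  rw [← sub_mul]
  exact (h i).mul_right _

/-- A character of exact order `p ^ m` is the composition of a linear form with a unit coefficient
and the character of `ℤ_p` defined by a primitive root of unity. -/
theorem exists_eq_zpowChar_comp_linForm {m : ℕ} {χ : FreeProP p d →* (PadicAlgCl p)ˣ}
    (hχ : ∀ g, χ g ^ p ^ (m + 1) = 1) (hχ' : ¬ ∀ g, χ g ^ p ^ m = 1) :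
    ∃ (l : Fin d → ℤ_[p]) (ω : (PadicAlgCl p)ˣ) (hω : ω ^ p ^ (m + 1) = 1),
      IsPrimitiveRoot ω (p ^ (m + 1)) ∧ (∃ j, ‖l j‖ = 1) ∧
      ∀ g, χ g = zpowChar ω hω (linForm l g) := by
  have hp : p.Prime := Fact.out
  have : NeZero (p ^ (m + 1)) := ⟨(pow_pos hp.pos _).ne'⟩
  obtain ⟨ω₀, hω₀⟩ := HasEnoughRootsOfUnity.exists_primitiveRoot (PadicAlgCl p) (p ^ (m + 1))
  obtain ⟨ω, rfl⟩ := hω₀.isUnit (NeZero.ne _)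
  have hω : IsPrimitiveRoot ω (p ^ (m + 1)) := IsPrimitiveRoot.coe_units_iff.1 hω₀
  have h1 : ∀ i, ∃ a : ℕ, ω ^ a = χ (Multiplicative.ofAdd (Pi.single i 1)) := fun i => by
    obtain ⟨a, -, ha⟩ := hω.eq_pow_of_mem_rootsOfUnity (ξ := χ _) (hχ _)
    exact ⟨a, ha⟩
  choose a ha using h1
  have hall : ∀ g, χ g = zpowChar ω hω.pow_eq_one (linForm (fun i => (a i : ℤ_[p])) g) := by
    intro g
    refine DFunLike.congr_fun (char_ext (ψ := (zpowChar ω hω.pow_eq_one).comp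
      (linForm fun i => (a i : ℤ_[p]))) hχ (fun g => ?_) fun i => ?_) g
    · rw [MonoidHom.comp_apply]
      change (ω ^ _) ^ _ = _
      rw [pow_right_comm, hω.pow_eq_one, one_pow]
    · rw [MonoidHom.comp_apply, ← ha, ← zpowChar_natCast ω hω.pow_eq_one]
      congr 1
      apply Multiplicative.toAdd.injective
      change (a i : ℤ_[p]) = ∑ j, (a j : ℤ_[p]) * (Pi.single i 1 : Fin d → ℤ_[p]) j
      rw [Finset.sum_eq_single i]
      · simp
      · intro j _ hj
        simp [hj]
      · simp
  refine ⟨_, ω, hω.pow_eq_one, hω, ?_, hall⟩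
  by_contra hno
  push Not at hno
  refine hχ' fun g => ?_
  have h2 : ∀ i, p ∣ a i := fun i => by
    have h3 := lt_of_le_of_ne (PadicInt.norm_le_one _) (hno i)
    have h4 := (PadicInt.norm_int_lt_one_iff_dvd (p := p) (a i : ℤ)).1 (by exact_mod_cast h3)
    exact_mod_cast h4
  refine DFunLike.congr_fun (char_ext (m := m + 1) (χ := (powMonoidHom (p ^ m)).comp χ) (ψ := 1)
    (fun g => ?_) (fun g => ?_) fun i => ?_) g
  · change (χ g ^ p ^ m) ^ p ^ (m + 1) = 1
    rw [pow_right_comm, hχ, one_pow]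
  · simp
  · change χ _ ^ p ^ m = 1
    obtain ⟨c, hc⟩ := h2 i
    rw [← ha, hc, ← pow_mul, show p * c * p ^ m = p ^ (m + 1) * c by ring, pow_mul, hω.pow_eq_one,
      one_pow]

end Characters

/-! ### Counting zeros -/

section Counting

variable {p : ℕ} [Fact p.Prime] {d : ℕ}

theorem isCompact_setOf_exists_norm_eq_one : IsCompact {l : Fin d → ℤ_[p] | ∃ j, ‖l j‖ = 1} := by
  refine IsClosed.isCompact ?_
  have h : {l : Fin d → ℤ_[p] | ∃ j, ‖l j‖ = 1} = ⋃ j, {l | ‖l j‖ = 1} := by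
    ext l
    simp
  rw [h]
  exact isClosed_iUnion_of_finite fun j =>
    isClosed_eq (continuous_norm.comp (continuous_apply j)) continuous_const

theorem isPrimitiveRoot_zpowChar {M : Type*} [CommGroup M] {m : ℕ} {ω : M}
    (hω : IsPrimitiveRoot ω (p ^ m)) {x : ℤ_[p]} (hx : IsUnit x) :
    IsPrimitiveRoot (zpowChar ω hω.pow_eq_one (Multiplicative.ofAdd x)) (p ^ m) := by
  obtain ⟨u, rfl⟩ := hx
  exact hω.pow_of_coprime _ (ZMod.val_coe_unit_coprime (Units.map
    ((PadicInt.toZModPow (p := p) m : ℤ_[p] →+* ZMod (p ^ m)) : ℤ_[p] →* ZMod (p ^ m)) u))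

theorem zpowChar_pow_eq_one {M : Type*} [CommGroup M] {m k : ℕ} {ω : M} (hω : ω ^ p ^ m = 1)
    {x : ℤ_[p]} (hk : k ≤ m) (hx : (p : ℤ_[p]) ^ k ∣ x) :
    zpowChar ω hω (Multiplicative.ofAdd x) ^ p ^ (m - k) = 1 := by
  obtain ⟨c, rfl⟩ := hx
  rw [← map_pow]
  have h1 : Multiplicative.ofAdd ((p : ℤ_[p]) ^ k * c) ^ p ^ (m - k) =
      Multiplicative.ofAdd c ^ p ^ m := by
    apply Multiplicative.toAdd.injective
    rw [toAdd_pow, toAdd_pow, toAdd_ofAdd, toAdd_ofAdd, nsmul_eq_mul, nsmul_eq_mul, ← mul_assoc]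
    congr 1
    push_cast
    rw [← pow_add, Nat.sub_add_cancel hk]
  rw [h1, map_pow]
  change (ω ^ _) ^ _ = 1
  rw [pow_right_comm, hω, one_pow]

/-- For the decomposition `ℤ_p^(d+1) ≅ ℤ_p^d × ℤ_p` given by the linear form `l₀`, the hypotheses of
`exists_coeff_ideal` hold for the characters attached to linear forms close to `l₀`. -/
theorem zpowChar_linForm_of_close {j : Fin (d + 1)} {l₀ : Fin (d + 1) → ℤ_[p]} {u : ℤ_[p]ˣ}
    (hu : l₀ j = u) {l : Fin (d + 1) → ℤ_[p]} {k m : ℕ} (hkm : k < m)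
    (hl : ∀ i, (p : ℤ_[p]) ^ (k + 1) ∣ l i - l₀ i) {χ : FreeProP p (d + 1) →* (PadicAlgCl p)ˣ}
    {ω : (PadicAlgCl p)ˣ} (hω : IsPrimitiveRoot ω (p ^ m))
    (hχ : ∀ g, χ g = zpowChar ω hω.pow_eq_one (linForm l g)) :
    IsPrimitiveRoot (χ (genSnd (splitEquiv j l₀ u hu)) : PadicAlgCl p) (p ^ m) ∧
      ∀ g, restrictFst (splitEquiv j l₀ u hu) χ g ^ p ^ (m - k) = 1 := by
  have hlin : ∀ y, linForm l₀ ((splitEquiv j l₀ u hu).symm y) = y.2 := fun y =>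
    congrArg Prod.snd ((splitEquiv j l₀ u hu).apply_symm_apply y)
  constructor
  · rw [IsPrimitiveRoot.coe_units_iff, hχ]
    refine isPrimitiveRoot_zpowChar hω (x := (linForm l _).toAdd) ?_
    obtain ⟨c, hc⟩ := dvd_linForm_sub hl (genSnd (splitEquiv j l₀ u hu))
    rw [genSnd, hlin, toAdd_ofAdd, sub_eq_iff_eq_add] at hc
    rw [genSnd, hc, PadicInt.isUnit_iff, add_comm]
    have h1 : ‖(p : ℤ_[p]) ^ (k + 1) * c‖ < 1 := by
      rw [norm_mul, PadicInt.norm_p_pow]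
      refine mul_lt_one_of_nonneg_of_lt_one_left (by positivity) ?_ (PadicInt.norm_le_one c)
      exact zpow_lt_one_of_neg₀ (by exact_mod_cast (Fact.out : p.Prime).one_lt) (by omega)
    rw [IsUltrametricDist.norm_add_eq_max_of_norm_ne_norm (by rw [norm_one]; exact h1.ne'),
      norm_one, max_eq_left h1.le]
  · intro g
    change χ (inclFst _ g) ^ _ = 1
    rw [hχ]
    refine zpowChar_pow_eq_one hω.pow_eq_one hkm.le (x := (linForm l _).toAdd) ?_
    have h1 := dvd_linForm_sub hl (inclFst (splitEquiv j l₀ u hu) g)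
    have h2 : linForm l₀ (inclFst (splitEquiv j l₀ u hu) g) = 1 := hlin _
    rw [h2, toAdd_one, sub_zero] at h1
    exact (pow_dvd_pow _ (Nat.le_succ k)).trans h1

/-- Up to characters of bounded order, the zeros of an ideal of `ℤ_p[[ℤ_p^(d+1)]]` come from zeros
of finitely many ideals of `ℤ_p[[ℤ_p^d]]`: the linear forms with a unit coefficient form a compact
set, and `exists_coeff_ideal` applies near each of them. -/
theorem exists_finite_slices (J : Ideal (completedGroupAlgebra ℤ_[p] (FreeProP p (d + 1)))) :
    ∃ (ι : Type) (_ : Fintype ι)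
      (E : ι → (FreeProP p (d + 1) ≃ₜ* FreeProP p d × Multiplicative ℤ_[p]))
      (J' : ι → Ideal (completedGroupAlgebra ℤ_[p] (FreeProP p d))) (k : ℕ),
      (∀ i, J ≤ (J' i).map (mapGroup ℤ_[p] (inclFst (E i)))) ∧
      ∀ (n : ℕ) (χ), χ ∈ torsionZeros J n → (∀ g, χ g ^ p ^ k = 1) ∨
        ∃ i, restrictFst (E i) χ ∈ zeroLocus (J' i) := by
  classical
  have hp : p.Prime := Fact.out
  have h1 : ∀ l : {l : Fin (d + 1) → ℤ_[p] | ∃ j, ‖l j‖ = 1},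
      ∃ (j : Fin (d + 1)) (u : ℤ_[p]ˣ), l.1 j = u := by
    rintro ⟨l, j, hj⟩
    obtain ⟨u, hu⟩ := PadicInt.isUnit_iff.2 hj
    exact ⟨j, u, hu.symm⟩
  choose j u hu using h1
  choose J' k hJ hk using fun l => exists_coeff_ideal (splitEquiv (j l) l.1 (u l) (hu l)) J
  obtain ⟨t, ht⟩ := isCompact_setOf_exists_norm_eq_one.elim_nhds_subcover'
    (fun l hl => Metric.ball l ((p : ℝ) ^ (-(k ⟨l, hl⟩ + 1 : ℕ) : ℤ)))
    (fun l hl => Metric.ball_mem_nhds _ (zpow_pos (by exact_mod_cast hp.pos) _))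
  refine ⟨t, inferInstance, fun l => splitEquiv (j l.1) l.1.1 (u l.1) (hu l.1), fun l => J' l.1,
    t.sup k, fun l => hJ l.1, fun n χ hχ => ?_⟩
  obtain ⟨hχn, hχJ⟩ := hχ
  rw [or_iff_not_imp_left]
  intro hbig
  -- The exact order of `χ` is `p ^ m'`, where `m'` is the least exponent that kills `χ`.
  have hex : ∃ m, ∀ g, χ g ^ p ^ m = 1 := ⟨n, hχn⟩
  have hmspec := Nat.find_spec hex
  have hmmin := fun m => Nat.find_min hex (m := m)
  set m' := Nat.find hex
  have hlt : t.sup k < m' := by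
    by_contra hle
    refine hbig fun g => ?_
    obtain ⟨c, hc⟩ := pow_dvd_pow p (not_lt.1 hle)
    rw [hc, pow_mul, hmspec, one_pow]
  obtain ⟨m, hm⟩ := Nat.exists_eq_succ_of_ne_zero (Nat.ne_zero_of_lt hlt)
  rw [hm] at hmspec hlt
  obtain ⟨l, ω, _, hω, hl, hχl⟩ := exists_eq_zpowChar_comp_linForm hmspec
    (hmmin m (by rw [hm]; exact Nat.lt_succ_self m))
  have hl' := ht hl
  simp only [Set.mem_iUnion, exists_prop] at hl'
  obtain ⟨l₀, hl₀, hball⟩ := hl'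
  have hkm : k l₀ < m + 1 := (Finset.le_sup hl₀).trans_lt hlt
  have hclose : ∀ i, (p : ℤ_[p]) ^ (k l₀ + 1) ∣ l i - l₀.1 i := by
    intro i
    rw [← Ideal.mem_span_singleton, ← PadicInt.norm_le_pow_iff_mem_span_pow, ← dist_eq_norm]
    exact (dist_le_pi_dist _ _ i).trans (Metric.mem_ball.1 hball).le
  obtain ⟨h2, h3⟩ := zpowChar_linForm_of_close (hu l₀) hkm hclose hω hχl
  exact ⟨⟨l₀, hl₀⟩, hk l₀ (m + 1) χ hkm hmspec hχJ h2 h3⟩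

/-- A character of `ℤ_p^(d+1) ≅ ℤ_p^d × ℤ_p` killed by `p ^ n` is determined by its restriction to
the first factor and by its value at an element whose second component is `1`. -/
theorem bijOn_restrictFst (E : FreeProP p (d + 1) ≃ₜ* FreeProP p d × Multiplicative ℤ_[p])
    {γ : FreeProP p (d + 1)} (hγ : (E γ).2 = Multiplicative.ofAdd 1) (n : ℕ) :
    Set.BijOn (fun χ : FreeProP p (d + 1) →* (PadicAlgCl p)ˣ => (χ γ, restrictFst E χ))
      {χ | ∀ g, χ g ^ p ^ n = 1} ({x | x ^ p ^ n = 1} ×ˢ {ψ | ∀ g, ψ g ^ p ^ n = 1}) := by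
  refine ⟨fun χ hχ => ⟨hχ _, fun g => hχ _⟩, fun χ hχ ψ hψ h => ?_, ?_⟩
  · obtain ⟨h2, h3⟩ := Prod.mk.inj h
    refine MonoidHom.ext fun g => ?_
    obtain ⟨c, hc⟩ := Ideal.mem_span_singleton.1 (PadicInt.appr_spec n (E g).2.toAdd)
    have hg : g = inclFst E ((E g).1 * ((E γ).1 ^ (E g).2.toAdd.appr n)⁻¹) *
        γ ^ (E g).2.toAdd.appr n * (E.symm (1, Multiplicative.ofAdd c)) ^ p ^ n := by
      change g = E.symm _ * _ * _
      apply E.injective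
      rw [map_mul, map_mul, map_pow, map_pow, ContinuousMulEquiv.apply_symm_apply,
        ContinuousMulEquiv.apply_symm_apply]
      ext1
      · simp
      · apply Multiplicative.toAdd.injective
        simp only [Prod.snd_mul, Prod.pow_snd, one_mul, toAdd_mul, toAdd_pow, toAdd_ofAdd,
          nsmul_eq_mul, mul_one, Nat.cast_pow, hγ]
        rw [← hc]
        ring
    have h4 : ∀ x, χ (inclFst E x) = ψ (inclFst E x) := DFunLike.congr_fun h3
    have h5 : ∀ θ : FreeProP p (d + 1) →* (PadicAlgCl p)ˣ, (∀ g, θ g ^ p ^ n = 1) →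
        ∀ x y a z, θ (x * y ^ a * z ^ p ^ n) = θ x * θ y ^ a := fun θ hθ x y a z => by
      rw [map_mul, map_mul, map_pow, map_pow, hθ, mul_one]
    rw [hg, h5 χ hχ, h5 ψ hψ, h2, h4]
  · rintro ⟨x, ψ⟩ ⟨hx, hψ⟩
    have hω : (x * (ψ (E γ).1)⁻¹) ^ p ^ n = 1 := by
      rw [mul_pow, inv_pow, hψ, hx, inv_one, mul_one]
    have hval : ∀ t, zpowChar _ hω t ^ p ^ n = 1 := fun t => by
      change ((x * (ψ (E γ).1)⁻¹) ^ _) ^ _ = 1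
      rw [pow_right_comm, hω, one_pow]
    have hone : zpowChar _ hω (Multiplicative.ofAdd 1) = x * (ψ (E γ).1)⁻¹ := by
      have h1 := zpowChar_natCast _ hω 1
      rwa [Nat.cast_one, pow_one] at h1
    refine ⟨(ψ.comp (MonoidHom.fst _ _) * (zpowChar _ hω).comp (MonoidHom.snd _ _)).comp
      (E : FreeProP p (d + 1) →* FreeProP p d × Multiplicative ℤ_[p]), fun g => ?_, ?_⟩
    · change (ψ (E g).1 * zpowChar _ hω (E g).2) ^ _ = 1
      rw [mul_pow, hψ, hval, one_mul]
    · refine Prod.ext ?_ (MonoidHom.ext fun y => ?_)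
      · change ψ (E γ).1 * zpowChar _ hω (E γ).2 = x
        rw [hγ, hone, mul_comm, inv_mul_cancel_right]
      · change ψ (E (E.symm (y, 1))).1 * zpowChar _ hω (E (E.symm (y, 1))).2 = ψ y
        rw [ContinuousMulEquiv.apply_symm_apply, map_one, mul_one]

theorem ncard_restrictFst (E : FreeProP p (d + 1) ≃ₜ* FreeProP p d × Multiplicative ℤ_[p])
    {γ : FreeProP p (d + 1)} (hγ : (E γ).2 = Multiplicative.ofAdd 1) (n : ℕ)
    {R : Set (PadicAlgCl p)ˣ} (hR : ∀ x ∈ R, x ^ p ^ n = 1)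
    {S : Set (FreeProP p d →* (PadicAlgCl p)ˣ)} (hS : ∀ ψ ∈ S, ∀ g, ψ g ^ p ^ n = 1) :
    {χ : FreeProP p (d + 1) →* (PadicAlgCl p)ˣ |
      (∀ g, χ g ^ p ^ n = 1) ∧ χ γ ∈ R ∧ restrictFst E χ ∈ S}.ncard = R.ncard * S.ncard := by
  obtain ⟨-, hinj, hsurj⟩ := bijOn_restrictFst E hγ n
  rw [← Set.ncard_prod, ← (hinj.mono fun χ hχ => hχ.1).ncard_image]
  congr 1
  ext ⟨x, ψ⟩
  constructor
  · rintro ⟨χ, hχ, h⟩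
    rw [← h]
    exact hχ.2
  · rintro ⟨hx, hψ⟩
    obtain ⟨χ, hχ, h⟩ := hsurj (Set.mk_mem_prod (hR x hx) (hS ψ hψ))
    obtain ⟨rfl, rfl⟩ := Prod.mk.inj h
    exact ⟨χ, ⟨hχ, hx, hψ⟩, rfl⟩

theorem genSnd_snd (E : FreeProP p (d + 1) ≃ₜ* FreeProP p d × Multiplicative ℤ_[p]) :
    (E (genSnd E)).2 = Multiplicative.ofAdd 1 := by
  rw [genSnd, ContinuousMulEquiv.apply_symm_apply]

/-- The growth of the number of zeros on `ℤ_p^(d+1)`: none for `d = 0`, and `p ^ (n * (d - 1))` up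
to a constant factor for `d ≥ 1`. -/
def growth (p : ℕ) : ℕ → ℕ → ℕ
  | 0, _ => 0
  | d + 1, n => p ^ (n * d)

/-- An ideal that is not contained in the ideal generated by a simple element has few zeros. -/
theorem exists_ncard_torsionZeros_le (d : ℕ)
    (J : Ideal (completedGroupAlgebra ℤ_[p] (FreeProP p (d + 1))))
    (hJ : ∀ s, IsSimpleElement p s → ¬ J ≤ Ideal.span {s}) :
    ∃ C : ℕ, ∀ n, (torsionZeros J n).ncard ≤ C * growth p d n := by
  have hp : p.Prime := Fact.out
  induction d with
  | zero =>
    refine ⟨0, fun n => ?_⟩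
    have h : torsionZeros J n = ∅ := Set.eq_empty_of_forall_notMem fun χ hχ => by
      obtain ⟨s, hs, hle⟩ := exists_isSimpleElement_of_mem_zeroLocus J hχ
      exact hJ s hs hle
    simp [h]
  | succ d ih =>
    obtain ⟨ι, _, E, J', k, hle, hcover⟩ := exists_finite_slices J
    have hJ' : ∀ i s, IsSimpleElement p s → ¬ J' i ≤ Ideal.span {s} := by
      intro i s hs hs'
      refine hJ _ (isSimpleElement_mapGroup_inclFst (E i) hs) ((hle i).trans ?_)
      refine (Ideal.map_mono hs').trans ?_
      rw [Ideal.map_span, Set.image_singleton]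
    choose C hC using fun i => ih (J' i) (hJ' i)
    set C₀ := {χ : FreeProP p (d + 1 + 1) →* (PadicAlgCl p)ˣ | ∀ g, χ g ^ p ^ k = 1}.ncard
    refine ⟨C₀ + ∑ i, C i, fun n => ?_⟩
    have hsub : torsionZeros J n ⊆
        {χ : FreeProP p (d + 1 + 1) →* (PadicAlgCl p)ˣ | ∀ g, χ g ^ p ^ k = 1} ∪
        ⋃ i, {χ : FreeProP p (d + 1 + 1) →* (PadicAlgCl p)ˣ |
          (∀ g, χ g ^ p ^ n = 1) ∧ restrictFst (E i) χ ∈ torsionZeros (J' i) n} := by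
      intro χ hχ
      rcases hcover n χ hχ with h | ⟨i, hi⟩
      · exact Or.inl h
      · exact Or.inr (Set.mem_iUnion.2 ⟨i, hχ.1, fun g => hχ.1 _, hi⟩)
    have hfin : ∀ i, {χ : FreeProP p (d + 1 + 1) →* (PadicAlgCl p)ˣ |
          (∀ g, χ g ^ p ^ n = 1) ∧ restrictFst (E i) χ ∈ torsionZeros (J' i) n}.Finite := fun i =>
      (finite_torsionChars n).subset fun _ h => h.1
    have hgrow : 1 ≤ growth p (d + 1) n := Nat.one_le_pow _ _ hp.pos
    have hgrow' : p ^ n * growth p d n ≤ growth p (d + 1) n := by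
      rcases d with _ | d
      · simp [growth]
      · simp only [growth]
        rw [← pow_add, Nat.mul_succ, add_comm]
    have hi : ∀ i, {χ : FreeProP p (d + 1 + 1) →* (PadicAlgCl p)ˣ |
          (∀ g, χ g ^ p ^ n = 1) ∧ restrictFst (E i) χ ∈ torsionZeros (J' i) n}.ncard ≤
        C i * growth p (d + 1) n := by
      intro i
      have h1 := ncard_restrictFst (E i) (genSnd_snd (E i)) n
        (R := {x | x ^ p ^ n = 1}) (fun x hx => hx) (S := torsionZeros (J' i) n) fun ψ hψ => hψ.1
      rw [ncard_setOf_pow_eq_one] at h1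
      calc _ ≤ p ^ n * (torsionZeros (J' i) n).ncard := by
            rw [← h1]
            exact Set.ncard_le_ncard (fun χ hχ => ⟨hχ.1, hχ.1 _, hχ.2⟩)
              ((finite_torsionChars n).subset fun _ h => h.1)
        _ ≤ p ^ n * (C i * growth p d n) := Nat.mul_le_mul_left _ (hC i n)
        _ = C i * (p ^ n * growth p d n) := by ring
        _ ≤ _ := Nat.mul_le_mul_left _ hgrow'
    calc (torsionZeros J n).ncard ≤ _ :=
          Set.ncard_le_ncard hsub ((finite_torsionChars k).union (Set.finite_iUnion hfin))
      _ ≤ C₀ + (⋃ i, {χ : FreeProP p (d + 1 + 1) →* (PadicAlgCl p)ˣ |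
          (∀ g, χ g ^ p ^ n = 1) ∧ restrictFst (E i) χ ∈ torsionZeros (J' i) n}).ncard :=
          Set.ncard_union_le _ _
      _ ≤ C₀ + ∑ i, {χ : FreeProP p (d + 1 + 1) →* (PadicAlgCl p)ˣ |
          (∀ g, χ g ^ p ^ n = 1) ∧ restrictFst (E i) χ ∈ torsionZeros (J' i) n}.ncard :=
          Nat.add_le_add_left (Set.ncard_iUnion_le_of_fintype _) _
      _ ≤ C₀ * growth p (d + 1) n + ∑ i, C i * growth p (d + 1) n :=
          Nat.add_le_add (Nat.le_mul_of_pos_right _ hgrow) (Finset.sum_le_sum fun i _ => hi i)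
      _ = (C₀ + ∑ i, C i) * growth p (d + 1) n := by rw [add_mul, Finset.sum_mul]

end Counting

/-! ### Ranks and characters -/

section Rank

/-- The rank of a finitely generated module over a principal ideal domain `R` is the dimension of
its dual with values in a field containing `R`. -/
theorem finrank_linearMap_eq {R M K : Type*} [CommRing R] [IsDomain R] [IsPrincipalIdealRing R]
    [AddCommGroup M] [Module R M] [Module.Finite R M] [Field K] [Algebra R K] [FaithfulSMul R K] :
    Module.finrank K (M →ₗ[R] K) = Module.finrank R M := by
  rw [← finrank_quotient_eq_of_le_torsion (le_refl (Submodule.torsion R M)),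
    ← Module.finrank_linearMap_self R K (M ⧸ Submodule.torsion R M)]
  let φ : ((M ⧸ Submodule.torsion R M) →ₗ[R] K) →ₗ[K] (M →ₗ[R] K) :=
    { toFun := fun f => f ∘ₗ (Submodule.torsion R M).mkQ
      map_add' := fun _ _ => rfl
      map_smul' := fun _ _ => rfl }
  refine (LinearEquiv.finrank_eq (LinearEquiv.ofBijective φ ⟨fun f g h => ?_, fun f => ?_⟩)).symm
  · exact Submodule.linearMap_qext _ h
  · refine ⟨(Submodule.torsion R M).liftQ f fun x hx => ?_, Submodule.liftQ_mkQ _ _ _⟩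
    obtain ⟨a, ha⟩ := (Submodule.mem_torsion_iff x).1 hx
    rw [LinearMap.mem_ker]
    have h1 : algebraMap R K a * f x = 0 := by
      rw [← Algebra.smul_def, ← map_smul]
      exact (congrArg f ha).trans (map_zero f)
    refine (mul_eq_zero.1 h1).resolve_left fun h2 => nonZeroDivisors.ne_zero a.2 ?_
    exact (FaithfulSMul.algebraMap_eq_zero_iff R K).1 h2

variable {R Q K : Type*} [CommRing R] [CommGroup Q] [Field K] [Algebra R K]

/-- The homomorphism `R[Q] → K` attached to a character of `Q`. -/
def liftChar (R : Type*) {Q K : Type*} [CommRing R] [CommGroup Q] [Field K] [Algebra R K]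
    (ψ : Q →* Kˣ) : MonoidAlgebra R Q →ₐ[R] K :=
  MonoidAlgebra.lift R K Q ((Units.coeHom K).comp ψ)

theorem liftChar_single (ψ : Q →* Kˣ) (q : Q) (r : R) :
    liftChar R ψ (MonoidAlgebra.single q r) = r • (ψ q : K) :=
  MonoidAlgebra.lift_single _ _ _

theorem linearIndependent_char : LinearIndependent K fun (ψ : Q →* Kˣ) (q : Q) => (ψ q : K) := by
  refine (linearIndependent_monoidHom Q K).comp (fun ψ : Q →* Kˣ => (Units.coeHom K).comp ψ) ?_
  intro ψ ψ' h
  exact MonoidHom.ext fun q => Units.ext (DFunLike.congr_fun h q)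

/-- The characters of the finite group `Q` at which the ideal `a` of `R[Q]` vanishes. -/
def charZeros (K : Type*) [Field K] [Algebra R K] (a : Ideal (MonoidAlgebra R Q)) :
    Set (Q →* Kˣ) :=
  {ψ | ∀ f ∈ a, liftChar R ψ f = 0}

theorem finite_char (Q K : Type*) [CommGroup Q] [Field K] [Finite Q] [IsAlgClosed K] [CharZero K] :
    Finite (Q →* Kˣ) :=
  Nat.finite_of_card_ne_zero
    ((CommGroup.card_monoidHom_of_hasEnoughRootsOfUnity Q K).trans_ne Nat.card_pos.ne')

theorem exists_eq_sum_liftChar [Finite Q] [IsAlgClosed K] [CharZero K] [Fintype (Q →* Kˣ)]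
    (φ : MonoidAlgebra R Q →ₗ[R] K) :
    ∃ c : (Q →* Kˣ) → K, ∀ x, φ x = ∑ ψ, c ψ * liftChar R ψ x := by
  have := Fintype.ofFinite Q
  have htop : Submodule.span K (Set.range fun (ψ : Q →* Kˣ) (q : Q) => (ψ q : K)) = ⊤ := by
    refine linearIndependent_char.span_eq_top_of_card_eq_finrank ?_
    rw [Module.finrank_fintype_fun_eq_card, ← Nat.card_eq_fintype_card,
      CommGroup.card_monoidHom_of_hasEnoughRootsOfUnity, Nat.card_eq_fintype_card]
  have h1 : (fun q => φ (MonoidAlgebra.single q 1)) ∈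
      Submodule.span K (Set.range fun (ψ : Q →* Kˣ) (q : Q) => (ψ q : K)) :=
    htop ▸ Submodule.mem_top
  obtain ⟨c, hc⟩ := (Submodule.mem_span_range_iff_exists_fun K).1 h1
  refine ⟨c, fun x => ?_⟩
  induction x using MonoidAlgebra.induction_on with
  | of q =>
    refine (congrFun hc q).symm.trans ?_
    rw [Finset.sum_apply]
    refine Finset.sum_congr rfl fun ψ _ => ?_
    rw [MonoidAlgebra.of_apply, liftChar_single, one_smul, Pi.smul_apply, smul_eq_mul]
  | add x y hx hy =>
    rw [map_add, hx, hy, ← Finset.sum_add_distrib]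
    exact Finset.sum_congr rfl fun ψ _ => by rw [map_add, mul_add]
  | smul r x hx =>
    rw [map_smul, hx, Finset.smul_sum]
    exact Finset.sum_congr rfl fun ψ _ => by rw [map_smul, mul_smul_comm]

/-- If a combination of characters vanishes on an ideal of `R[Q]`, then so does every character
that occurs in it: the ideal is stable under multiplication by `Q`, and characters are
independent. -/
theorem mem_charZeros_of_sum_eq_zero [Fintype (Q →* Kˣ)] {a : Ideal (MonoidAlgebra R Q)}
    {c : (Q →* Kˣ) → K} (hc : ∀ f ∈ a, ∑ ψ, c ψ * liftChar R ψ f = 0) {ψ₀ : Q →* Kˣ}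
    (h : c ψ₀ ≠ 0) : ψ₀ ∈ charZeros K a := by
  intro f hf
  have h4 : ∑ ψ : Q →* Kˣ, (c ψ * liftChar R ψ f) • (fun q : Q => (ψ q : K)) = 0 := by
    funext q
    have h5 := hc _ (Ideal.mul_mem_right (MonoidAlgebra.single q 1) a hf)
    rw [Finset.sum_apply, Pi.zero_apply, ← h5]
    refine Finset.sum_congr rfl fun ψ _ => ?_
    rw [map_mul, liftChar_single, one_smul, ← mul_assoc, Pi.smul_apply, smul_eq_mul]
  have h6 : c ψ₀ * liftChar R ψ₀ f = 0 :=
    Fintype.linearIndependent_iff.1 (linearIndependent_char (Q := Q) (K := K))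
      (fun ψ => c ψ * liftChar R ψ f) h4 ψ₀
  exact (mul_eq_zero.1 h6).resolve_left h

/-- The functional on `R[Q]/a` defined by a zero of `a`. -/
def quotientChar {a : Ideal (MonoidAlgebra R Q)} (ψ : charZeros K a) :
    (MonoidAlgebra R Q ⧸ a) →ₗ[R] K :=
  (Ideal.Quotient.liftₐ a (liftChar R ψ.1) ψ.2).toLinearMap

theorem quotientChar_mk {a : Ideal (MonoidAlgebra R Q)} (ψ : charZeros K a)
    (x : MonoidAlgebra R Q) :
    quotientChar ψ (Ideal.Quotient.mkₐ R a x) = liftChar R ψ.1 x :=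
  rfl

theorem linearIndependent_quotientChar (a : Ideal (MonoidAlgebra R Q)) :
    LinearIndependent K (quotientChar (K := K) (a := a)) := by
  let ev : ((MonoidAlgebra R Q ⧸ a) →ₗ[R] K) →ₗ[K] (Q → K) :=
    { toFun := fun f q => f (Ideal.Quotient.mkₐ R a (MonoidAlgebra.single q 1))
      map_add' := fun _ _ => rfl
      map_smul' := fun _ _ => rfl }
  refine LinearIndependent.of_comp ev ?_
  have h1 : ev ∘ quotientChar (K := K) (a := a) =
      (fun (ψ : Q →* Kˣ) (q : Q) => (ψ q : K)) ∘ Subtype.val := by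
    funext ψ q
    change quotientChar ψ (Ideal.Quotient.mkₐ R a _) = _
    rw [quotientChar_mk, liftChar_single, one_smul, Function.comp_apply]
  rw [h1]
  exact linearIndependent_char.comp _ Subtype.val_injective

theorem top_le_span_quotientChar [Finite Q] [IsAlgClosed K] [CharZero K]
    (a : Ideal (MonoidAlgebra R Q)) :
    ⊤ ≤ Submodule.span K (Set.range (quotientChar (K := K) (a := a))) := by
  classical
  have := finite_char Q K
  have := Fintype.ofFinite (Q →* Kˣ)
  intro φ _
  obtain ⟨c, hc⟩ := exists_eq_sum_liftChar (φ ∘ₗ (Ideal.Quotient.mkₐ R a).toLinearMap)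
  have h3 : ∀ ψ, c ψ ≠ 0 → ψ ∈ charZeros K a := fun ψ hψ =>
    mem_charZeros_of_sum_eq_zero (fun f hf => by
      rw [← hc, LinearMap.comp_apply, AlgHom.toLinearMap_apply, Ideal.Quotient.mkₐ_eq_mk,
        Ideal.Quotient.eq_zero_iff_mem.2 hf, map_zero]) hψ
  have h4 : φ = ∑ ψ : charZeros K a, c ψ.1 • quotientChar ψ := by
    refine LinearMap.ext fun x => ?_
    obtain ⟨x, rfl⟩ := Ideal.Quotient.mkₐ_surjective R a x
    refine (hc x).trans ?_
    rw [LinearMap.sum_apply]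
    have h5 : ∀ ψ : charZeros K a, (c ψ.1 • quotientChar ψ) (Ideal.Quotient.mkₐ R a x) =
        c ψ.1 * liftChar R ψ.1 x := fun ψ => by
      rw [LinearMap.smul_apply, quotientChar_mk, smul_eq_mul]
    rw [Finset.sum_congr rfl fun ψ _ => h5 ψ]
    rw [← Finset.sum_subtype (Finset.univ.filter (· ∈ charZeros K a)) (by simp)
      (fun ψ => c ψ * liftChar R ψ x)]
    refine (Finset.sum_subset (Finset.subset_univ _) fun ψ _ hψ => ?_).symm
    have h6 : c ψ = 0 := not_imp_comm.1 (h3 ψ) fun hm =>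
      hψ (Finset.mem_filter.2 ⟨Finset.mem_univ _, hm⟩)
    rw [h6, zero_mul]
  rw [h4]
  exact Submodule.sum_mem _ fun ψ _ => Submodule.smul_mem _ _ (Submodule.subset_span ⟨ψ, rfl⟩)

/-- The characters at which `a` vanishes form a basis of the dual of `R[Q]/a`. -/
theorem finrank_dual_quotient_eq [Finite Q] [IsAlgClosed K] [CharZero K]
    (a : Ideal (MonoidAlgebra R Q)) :
    Module.finrank K ((MonoidAlgebra R Q ⧸ a) →ₗ[R] K) = (charZeros K a).ncard :=
  Module.finrank_eq_nat_card_basis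
    (Module.Basis.mk (linearIndependent_quotientChar a) (top_le_span_quotientChar a))

end Rank

/-! ### The rank of the layers -/

section LayerRank

variable {p : ℕ} [Fact p.Prime] {d : ℕ} {Γ : Type*} [CommGroup Γ] [TopologicalSpace Γ]
  (e : Γ ≃ₜ* Multiplicative (Fin d → ℤ_[p]))

theorem finite_quotient_layer (n : ℕ) : Finite (Γ ⧸ (layer e n : Subgroup Γ)) := by
  have : CompactSpace Γ := e.toHomeomorph.symm.compactSpace
  have : IsTopologicalGroup Γ :=
    Topology.IsInducing.topologicalGroup e e.toHomeomorph.isInducing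
  exact Subgroup.quotient_finite_of_isOpen _ (layer e n).isOpen'

theorem ker_mkₐ_comp_proj (J : Ideal (completedGroupAlgebra ℤ_[p] Γ)) (n : ℕ) :
    layerIdeal e n ⊔ J = RingHom.ker ((Ideal.Quotient.mkₐ ℤ_[p]
      (J.map (proj ℤ_[p] (layer e n)))).comp (proj ℤ_[p] (layer e n))) := by
  refine Ideal.ext fun x => ?_
  rw [RingHom.mem_ker, AlgHom.comp_apply, Ideal.Quotient.mkₐ_eq_mk,
    Ideal.Quotient.eq_zero_iff_mem, ← Ideal.mem_comap,
    Ideal.comap_map_of_surjective (proj ℤ_[p] (layer e n)) (proj_surjective _) J, sup_comm]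
  rfl

/-- The quotient of `Λ` by `I_n + J` is the quotient of `ℤ_p[Γ/Γ^(p^n)]` by the image of `J`. -/
def quotientLayerEquiv (J : Ideal (completedGroupAlgebra ℤ_[p] Γ)) (n : ℕ) :
    (completedGroupAlgebra ℤ_[p] Γ ⧸ (layerIdeal e n ⊔ J)) ≃ₐ[ℤ_[p]]
      (MonoidAlgebra ℤ_[p] (Γ ⧸ (layer e n : Subgroup Γ)) ⧸ J.map (proj ℤ_[p] (layer e n))) :=
  (Ideal.quotientEquivAlgOfEq ℤ_[p] (ker_mkₐ_comp_proj e J n)).trans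
    (Ideal.quotientKerAlgEquivOfSurjective
      ((Ideal.Quotient.mkₐ_surjective ℤ_[p] _).comp (proj_surjective _)))

theorem ncard_charZeros_map_proj (J : Ideal (completedGroupAlgebra ℤ_[p] Γ)) (n : ℕ) :
    (charZeros (PadicAlgCl p) (J.map (proj ℤ_[p] (layer e n)))).ncard =
      (torsionZeros J n).ncard := by
  have hinj : Function.Injective fun ψ : Γ ⧸ (layer e n : Subgroup Γ) →* (PadicAlgCl p)ˣ =>
      ψ.comp (QuotientGroup.mk' _) := fun ψ ψ' h => QuotientGroup.monoidHom_ext _ h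
  rw [← Set.ncard_image_of_injective _ hinj]
  congr 1
  ext χ
  have hev : ∀ (ψ : Γ ⧸ (layer e n : Subgroup Γ) →* (PadicAlgCl p)ˣ)
      (hχ : IsOpen ((ψ.comp (QuotientGroup.mk' _)).ker : Set Γ)) x,
      evalChar ℤ_[p] _ hχ x = liftChar ℤ_[p] ψ (proj ℤ_[p] (layer e n) x) := by
    intro ψ hχ x
    have hle : (layer e n : Subgroup Γ) ≤ (ψ.comp (QuotientGroup.mk' _)).ker := fun g hg => by
      rw [MonoidHom.mem_ker, MonoidHom.comp_apply, QuotientGroup.mk'_apply,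
        (QuotientGroup.eq_one_iff g).2 hg, map_one]
    rw [evalChar_eq_lift _ hχ (layer e n) hle]
    have h1 : QuotientGroup.lift _ (ψ.comp (QuotientGroup.mk' _)) hle = ψ :=
      QuotientGroup.monoidHom_ext _ rfl
    rw [h1]
    rfl
  have htor : ∀ (ψ : Γ ⧸ (layer e n : Subgroup Γ) →* (PadicAlgCl p)ˣ) (g : Γ),
      ψ.comp (QuotientGroup.mk' _) g ^ p ^ n = 1 := by
    intro ψ g
    have h1 : g ^ p ^ n ∈ (layer e n : Subgroup Γ) := ⟨g, rfl⟩
    rw [← map_pow, MonoidHom.comp_apply, QuotientGroup.mk'_apply,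
      (QuotientGroup.eq_one_iff _).2 h1, map_one]
  constructor
  · rintro ⟨ψ, hψ, rfl⟩
    refine ⟨htor ψ, isOpen_ker_of_pow_eq_one e (htor ψ), fun f hf => ?_⟩
    rw [hev]
    exact hψ _ (Ideal.mem_map_of_mem _ hf)
  · rintro ⟨hn, hχ, hJ⟩
    have hle : (layer e n : Subgroup Γ) ≤ χ.ker := by
      rintro _ ⟨g, rfl⟩
      rw [MonoidHom.mem_ker, powMonoidHom_apply, map_pow, hn]
    obtain ⟨ψ, rfl⟩ : ∃ ψ : Γ ⧸ (layer e n : Subgroup Γ) →* (PadicAlgCl p)ˣ,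
        ψ.comp (QuotientGroup.mk' _) = χ := ⟨QuotientGroup.lift _ χ hle, rfl⟩
    refine ⟨ψ, fun f hf => ?_, rfl⟩
    have h1 : J.map (proj ℤ_[p] (layer e n)) ≤ RingHom.ker (liftChar ℤ_[p] ψ) := by
      rw [Ideal.map_le_iff_le_comap]
      intro x hx
      rw [Ideal.mem_comap, RingHom.mem_ker, ← hev ψ hχ]
      exact hJ x hx
    exact h1 hf

/-- The rank of `Λ/(I_n + J)` is the number of zeros of `J` among the characters of
`Γ/Γ^(p^n)`. -/
theorem finrank_quotient_eq_ncard (J : Ideal (completedGroupAlgebra ℤ_[p] Γ)) (n : ℕ) :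
    Module.finrank ℤ_[p] (completedGroupAlgebra ℤ_[p] Γ ⧸ (layerIdeal e n ⊔ J)) =
      (torsionZeros J n).ncard := by
  have := finite_quotient e n J
  have := finite_quotient_layer e n
  have : Module.Finite ℤ_[p] (MonoidAlgebra ℤ_[p] (Γ ⧸ (layer e n : Subgroup Γ)) ⧸
    J.map (proj ℤ_[p] (layer e n))) := Module.Finite.equiv (quotientLayerEquiv e J n).toLinearEquiv
  have : FaithfulSMul ℤ_[p] (PadicAlgCl p) := by
    rw [faithfulSMul_iff_algebraMap_injective, IsScalarTower.algebraMap_eq ℤ_[p] ℚ_[p]]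
    exact (algebraMap ℚ_[p] (PadicAlgCl p)).injective.comp (IsFractionRing.injective ℤ_[p] ℚ_[p])
  rw [(quotientLayerEquiv e J n).toLinearEquiv.finrank_eq,
    ← finrank_linearMap_eq (K := PadicAlgCl p), finrank_dual_quotient_eq,
    ncard_charZeros_map_proj]

end LayerRank

/-! ### Zeros of simple elements -/

section SimpleZeros

variable {p : ℕ} [Fact p.Prime] {d : ℕ}

/-- The number of characters of `ℤ_p^d` killed by `p ^ n`. -/
theorem ncard_torsionChars (d n : ℕ) :
    {χ : FreeProP p d →* (PadicAlgCl p)ˣ | ∀ g, χ g ^ p ^ n = 1}.ncard = p ^ (n * d) := by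
  induction d with
  | zero =>
    rw [mul_zero, pow_zero, Set.ncard_eq_one]
    refine ⟨1, Set.eq_singleton_iff_unique_mem.2 ⟨fun g => by simp, fun χ _ => ?_⟩⟩
    refine MonoidHom.ext fun g => ?_
    rw [Subsingleton.elim g 1, map_one, map_one]
  | succ d ih =>
    have h1 := ncard_restrictFst (p := p) _
      (genSnd_snd (splitEquiv (0 : Fin (d + 1)) (fun _ => 1) 1 rfl)) n
      (R := {x | x ^ p ^ n = 1}) (fun x hx => hx)
      (S := {ψ | ∀ g, ψ g ^ p ^ n = 1}) (fun ψ hψ => hψ)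
    rw [ih, ncard_setOf_pow_eq_one, ← pow_add] at h1
    rw [Nat.mul_succ, add_comm (n * d) n, ← h1]
    congr 1
    ext χ
    exact ⟨fun h => ⟨h, h _, fun g => h _⟩, fun h => h.1⟩

/-- An element of `ℤ_p^(d+1)` that is not a `p`-th power has second component `1` in a suitable
decomposition `ℤ_p^(d+1) ≅ ℤ_p^d × ℤ_p`. -/
theorem exists_splitEquiv {γ : FreeProP p (d + 1)} (hγ : ¬ ∃ δ, δ ^ p = γ) :
    ∃ E : FreeProP p (d + 1) ≃ₜ* FreeProP p d × Multiplicative ℤ_[p],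
      (E γ).2 = Multiplicative.ofAdd 1 := by
  have h1 : ∃ j, IsUnit (γ.toAdd j) := by
    by_contra! h
    have h2 : ∀ j, ∃ c, γ.toAdd j = p * c := fun j => by
      have h3 := h j
      rw [PadicInt.not_isUnit_iff, PadicInt.norm_lt_one_iff_dvd] at h3
      exact h3
    choose c hc using h2
    refine hγ ⟨Multiplicative.ofAdd c, ?_⟩
    apply Multiplicative.toAdd.injective
    funext j
    rw [hc, toAdd_pow]
    simp
  obtain ⟨j, u, hu⟩ := h1
  refine ⟨splitEquiv j (Pi.single j ((u⁻¹ : ℤ_[p]ˣ) : ℤ_[p])) u⁻¹ (Pi.single_eq_same _ _), ?_⟩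
  apply Multiplicative.toAdd.injective
  change ∑ i, (Pi.single j ((u⁻¹ : ℤ_[p]ˣ) : ℤ_[p]) : Fin (d + 1) → ℤ_[p]) i * γ.toAdd i = 1
  rw [Finset.sum_eq_single j (fun i _ hi => by rw [Pi.single_eq_of_ne hi, zero_mul]) (by simp),
    Pi.single_eq_same, ← hu, Units.inv_mul]

theorem aeval_minpoly_padicInt {ζ : AlgebraicClosure ℚ_[p]} (hζ : IsPPowerRootOfUnity p ζ)
    (x : AlgebraicClosure ℚ_[p]) :
    aeval x (minpoly ℤ_[p] ζ) = aeval x (minpoly ℚ_[p] ζ) := by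
  rw [minpoly.isIntegrallyClosed_eq_field_fractions' ℚ_[p]
    (isIntegral_of_isPPowerRootOfUnity p hζ), aeval_map_algebraMap]

/-- The conjugates of a root of unity of `p`-power order `ζ` over `ℚ_p`. -/
def conjugates (p : ℕ) [Fact p.Prime] (ζ : AlgebraicClosure ℚ_[p]) : Set (PadicAlgCl p)ˣ :=
  {x | aeval (x : PadicAlgCl p) (minpoly ℤ_[p] ζ) = 0}

theorem pow_eq_one_of_aeval_minpoly {ζ x : AlgebraicClosure ℚ_[p]} {n : ℕ} (hζ : ζ ^ p ^ n = 1)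
    (hx : aeval x (minpoly ℚ_[p] ζ) = 0) : x ^ p ^ n = 1 := by
  have h1 : minpoly ℚ_[p] ζ ∣ X ^ p ^ n - 1 := minpoly.dvd _ _ (by simp [hζ])
  obtain ⟨Q, hQ⟩ := h1
  have h2 := congrArg (aeval x) hQ
  rw [map_mul, hx, zero_mul] at h2
  simpa [sub_eq_zero] using h2

theorem pow_eq_one_of_mem_conjugates {ζ : AlgebraicClosure ℚ_[p]} {n : ℕ} (hζ : ζ ^ p ^ n = 1)
    {x : (PadicAlgCl p)ˣ} (hx : x ∈ conjugates p ζ) : x ^ p ^ n = 1 := by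
  refine Units.ext ?_
  rw [Units.val_pow_eq_pow_val, Units.val_one]
  refine pow_eq_one_of_aeval_minpoly hζ ?_
  rw [← aeval_minpoly_padicInt ⟨n, hζ⟩]
  exact hx

theorem ncard_conjugates {ζ : AlgebraicClosure ℚ_[p]} (hζ : IsPPowerRootOfUnity p ζ) :
    (conjugates p ζ).ncard = Module.finrank ℚ_[p] ℚ_[p]⟮ζ⟯ := by
  have hint : IsIntegral ℚ_[p] ζ := Algebra.IsIntegral.isIntegral ζ
  have h1 : (Units.val '' conjugates p ζ) = (minpoly ℚ_[p] ζ).rootSet (AlgebraicClosure ℚ_[p]) := by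
    ext x
    rw [Polynomial.mem_rootSet_of_ne (minpoly.ne_zero hint)]
    constructor
    · rintro ⟨x, hx, rfl⟩
      rw [← aeval_minpoly_padicInt hζ]
      exact hx
    · intro hx
      obtain ⟨n, hn⟩ := hζ
      have h2 := pow_eq_one_of_aeval_minpoly hn hx
      have h3 : p ^ n ≠ 0 := (pow_pos (Fact.out : p.Prime).pos n).ne'
      obtain ⟨u, rfl⟩ := IsUnit.of_pow_eq_one h2 h3
      exact ⟨u, (aeval_minpoly_padicInt ⟨n, hn⟩ _).trans hx, rfl⟩
  rw [← Set.ncard_image_of_injective _ Units.val_injective, h1, adjoin.finrank hint,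
    ← Polynomial.card_rootSet_eq_natDegree (minpoly.irreducible hint).separable
      (IsAlgClosed.splits ((minpoly ℚ_[p] ζ).map (algebraMap ℚ_[p] (AlgebraicClosure ℚ_[p])))), Set.ncard_eq_toFinset_card', Set.toFinset_card]

theorem mem_zeroLocus_span_simpleElement_pow {Γ : Type*} [CommGroup Γ] [TopologicalSpace Γ]
    {χ : Γ →* (PadicAlgCl p)ˣ} (hχ : IsOpen (χ.ker : Set Γ)) {γ : Γ}
    {ζ : AlgebraicClosure ℚ_[p]} {m : ℕ} (hm : 0 < m) :
    χ ∈ zeroLocus (Ideal.span {simpleElement p γ ζ ^ m}) ↔ χ γ ∈ conjugates p ζ := by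
  constructor
  · rintro ⟨_, h⟩
    have h1 := h _ (Ideal.mem_span_singleton_self _)
    rw [map_pow, evalChar_simpleElement] at h1
    exact pow_eq_zero_iff hm.ne' |>.1 h1
  · intro h
    refine ⟨hχ, fun f hf => ?_⟩
    obtain ⟨g, rfl⟩ := Ideal.mem_span_singleton.1 hf
    have h1 : aeval (χ γ : PadicAlgCl p) (minpoly ℤ_[p] ζ) = 0 := h
    rw [map_mul, map_pow, evalChar_simpleElement, h1, zero_pow hm.ne', zero_mul]

/-- The zeros of `f_{γ,ζ} ^ m` are the characters whose value at `γ` is conjugate to `ζ`; each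
conjugate is attained by the same number of characters. -/
theorem ncard_torsionZeros_span_simpleElement_pow {γ : FreeProP p (d + 1)}
    (hγ : ¬ ∃ δ, δ ^ p = γ) {ζ : AlgebraicClosure ℚ_[p]} {m n : ℕ} (hm : 0 < m)
    (hn : ζ ^ p ^ n = 1) :
    (torsionZeros (Ideal.span {simpleElement p γ ζ ^ m}) n).ncard =
      Module.finrank ℚ_[p] ℚ_[p]⟮ζ⟯ * p ^ (n * d) := by
  obtain ⟨E, hE⟩ := exists_splitEquiv hγ
  rw [← ncard_conjugates ⟨n, hn⟩, ← ncard_torsionChars, ← ncard_restrictFst E hE n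
    (fun x hx => pow_eq_one_of_mem_conjugates hn hx)
    (S := {ψ | ∀ g, ψ g ^ p ^ n = 1}) (fun ψ hψ => hψ)]
  congr 1
  ext χ
  constructor
  · rintro ⟨h1, h2⟩
    exact ⟨h1, (mem_zeroLocus_span_simpleElement_pow (isOpen_ker_freeProP h1) hm).1 h2,
      fun g => h1 _⟩
  · rintro ⟨h1, h2, -⟩
    exact ⟨h1, (mem_zeroLocus_span_simpleElement_pow (isOpen_ker_freeProP h1) hm).2 h2⟩

end SimpleZeros

/-! ### Transport to `ℤ_p^d` and the growth of ranks -/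

theorem not_exists_pow_eq_map {G H : Type*} [CommGroup G] [CommGroup H] {p : ℕ} (e : G ≃* H) {γ : G}
    (hγ : ¬ ∃ δ, δ ^ p = γ) : ¬ ∃ δ, δ ^ p = e γ := by
  rintro ⟨δ, hδ⟩
  exact hγ ⟨e.symm δ, by rw [← map_pow, hδ, MulEquiv.symm_apply_apply]⟩

section Transfer

variable {p : ℕ} [Fact p.Prime] {d : ℕ} {Γ : Type*} [CommGroup Γ] [TopologicalSpace Γ]
  (e : Γ ≃ₜ* FreeProP p d)

theorem ncard_torsionZeros_map (J : Ideal (completedGroupAlgebra ℤ_[p] Γ)) (n : ℕ) :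
    (torsionZeros (J.map (mapGroup ℤ_[p] (e : Γ →ₜ* FreeProP p d))) n).ncard =
      (torsionZeros J n).ncard := by
  have hinj : Function.Injective fun χ : FreeProP p d →* (PadicAlgCl p)ˣ =>
      χ.comp ((e : Γ →ₜ* FreeProP p d) : Γ →* FreeProP p d) := fun χ ψ h =>
    MonoidHom.ext fun g => by
      obtain ⟨g, rfl⟩ := e.surjective g
      exact DFunLike.congr_fun h g
  rw [← Set.ncard_image_of_injective _ hinj]
  congr 1
  ext χ
  constructor
  · rintro ⟨χ, ⟨h1, h2⟩, rfl⟩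
    exact ⟨fun g => h1 _, (mem_zeroLocus_map (isOpen_ker_freeProP h1)).1 h2⟩
  · rintro ⟨h1, h2⟩
    have h3 : (χ.comp (e.symm : FreeProP p d →* Γ)).comp
        ((e : Γ →ₜ* FreeProP p d) : Γ →* FreeProP p d) = χ :=
      MonoidHom.ext fun g => congrArg χ (e.symm_apply_apply g)
    have h4 : ∀ g, χ.comp (e.symm : FreeProP p d →* Γ) g ^ p ^ n = 1 := fun g => h1 _
    refine ⟨χ.comp (e.symm : FreeProP p d →* Γ), ⟨h4, ?_⟩, h3⟩
    rw [mem_zeroLocus_map (isOpen_ker_freeProP h4), h3]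
    exact h2

theorem not_map_le_span_simpleElement {J : Ideal (completedGroupAlgebra ℤ_[p] Γ)}
    (hJ : ∀ s, IsSimpleElement p s → ¬ J ≤ Ideal.span {s})
    {s : completedGroupAlgebra ℤ_[p] (FreeProP p d)} (hs : IsSimpleElement p s) :
    ¬ J.map (mapGroup ℤ_[p] (e : Γ →ₜ* FreeProP p d)) ≤ Ideal.span {s} := by
  intro hle
  obtain ⟨γ, ζ, hγ, hζ, rfl⟩ := hs
  refine hJ (simpleElement p (e.symm γ) ζ)
    ⟨e.symm γ, ζ, not_exists_pow_eq_map e.symm.toMulEquiv hγ, hζ, rfl⟩ fun f hf => ?_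
  have h1 := Ideal.mem_map_of_mem (mapGroup ℤ_[p] (e.symm : FreeProP p d →ₜ* Γ))
    (hle (Ideal.mem_map_of_mem _ hf))
  rw [Ideal.map_span, Set.image_singleton, mapGroup_simpleElement, mapGroup_comp] at h1
  have h2 : (e.symm : FreeProP p d →ₜ* Γ).comp (e : Γ →ₜ* FreeProP p d) =
      ContinuousMonoidHom.id Γ := by
    ext g
    exact e.symm_apply_apply g
  rwa [h2, mapGroup_id] at h1

end Transfer

theorem growth_le_errorTerm (p d n : ℕ) : (growth p d n : ℝ) ≤ errorTerm p (d + 1) n := by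
  rcases d with _ | d
  · simp [growth, errorTerm]
  · simp [growth, errorTerm]

section Main

variable {p : ℕ} [Fact p.Prime] {d : ℕ} {Γ : Type*} [CommGroup Γ] [TopologicalSpace Γ]
  (e : Γ ≃ₜ* Multiplicative (Fin (d + 1) → ℤ_[p]))

theorem finrank_quotient_span_simpleElement_pow {γ : Γ}
    (hγ : ¬ ∃ δ, δ ^ p = γ) {ζ : AlgebraicClosure ℚ_[p]} {m n : ℕ} (hm : 0 < m)
    (hn : ζ ^ p ^ n = 1) :
    Module.finrank ℤ_[p] (completedGroupAlgebra ℤ_[p] Γ ⧸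
      (layerIdeal e n ⊔ Ideal.span {simpleElement p γ ζ ^ m})) =
      Module.finrank ℚ_[p] ℚ_[p]⟮ζ⟯ * p ^ (n * d) := by
  rw [finrank_quotient_eq_ncard, ← ncard_torsionZeros_map e, Ideal.map_span, Set.image_singleton,
    map_pow, mapGroup_simpleElement]
  exact ncard_torsionZeros_span_simpleElement_pow (not_exists_pow_eq_map e.toMulEquiv hγ) hm hn

/-- A simple element has a zero, so it is not a unit. -/
theorem not_isUnit_of_isSimpleElement
    (e : Γ ≃ₜ* Multiplicative (Fin (d + 1) → ℤ_[p])) {s : completedGroupAlgebra ℤ_[p] Γ}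
    (hs : IsSimpleElement p s) : ¬ IsUnit s := by
  obtain ⟨γ, ζ, hγ, ⟨n, hn⟩, rfl⟩ := hs
  intro hu
  have h1 := finrank_quotient_span_simpleElement_pow e hγ Nat.one_pos hn
  rw [pow_one, finrank_quotient_eq_ncard] at h1
  have h2 : 0 < (torsionZeros (Ideal.span {simpleElement p γ ζ}) n).ncard := by
    rw [h1]
    exact Nat.mul_pos Module.finrank_pos (pow_pos (Fact.out : p.Prime).pos _)
  obtain ⟨χ, -, hχ, h3⟩ := Set.nonempty_of_ncard_ne_zero h2.ne'
  have h4 := hu.map (evalChar ℤ_[p] χ hχ)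
  rw [h3 _ (Ideal.mem_span_singleton_self _)] at h4
  exact not_isUnit_zero h4

theorem isBigO_finrank_quotient {J : Ideal (completedGroupAlgebra ℤ_[p] Γ)}
    (hJ : ∀ s, IsSimpleElement p s → ¬ J ≤ Ideal.span {s}) :
    (fun n : ℕ => (Module.finrank ℤ_[p]
      (completedGroupAlgebra ℤ_[p] Γ ⧸ (layerIdeal e n ⊔ J)) : ℝ)) =O[atTop]
      fun n : ℕ => errorTerm p (d + 1) n := by
  obtain ⟨C, hC⟩ := exists_ncard_torsionZeros_le d
    (J.map (mapGroup ℤ_[p] (e : Γ →ₜ* FreeProP p (d + 1))))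
    fun s hs => not_map_le_span_simpleElement e hJ hs
  refine IsBigO.of_bound C (Eventually.of_forall fun n => ?_)
  rw [finrank_quotient_eq_ncard, ← ncard_torsionZeros_map e, Real.norm_natCast]
  calc _ ≤ ((C * growth p d n : ℕ) : ℝ) := Nat.cast_le.2 (hC n)
    _ = C * growth p d n := Nat.cast_mul _ _
    _ ≤ C * errorTerm p (d + 1) n :=
        mul_le_mul_of_nonneg_left (growth_le_errorTerm p d n) (Nat.cast_nonneg _)
    _ ≤ C * ‖errorTerm p (d + 1) n‖ :=
        mul_le_mul_of_nonneg_left (Real.le_norm_self _) (Nat.cast_nonneg _)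

end Main

end Iwasawa

end

theorem mainTheorem11 (p : ℕ) [Fact p.Prime] (d : ℕ) (hd : 1 ≤ d)
    {Γ : Type*} [CommGroup Γ] [TopologicalSpace Γ]
    (e : Γ ≃ₜ* Multiplicative (Fin d → ℤ_[p]))
    (J : Ideal (Iwasawa.completedGroupAlgebra ℤ_[p] Γ)) :
    (∀ (γ : Γ) (ζ : AlgebraicClosure ℚ_[p]) (m : ℕ),
      (¬ ∃ δ : Γ, δ ^ p = γ) → Iwasawa.IsPPowerRootOfUnity p ζ → 0 < m →
      J = Ideal.span {Iwasawa.simpleElement p γ ζ ^ m} →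
      ∀ᶠ n : ℕ in atTop,
        Module.finrank ℤ_[p]
            (Iwasawa.completedGroupAlgebra ℤ_[p] Γ ⧸ (Iwasawa.layerIdeal e n ⊔ J)) =
          Module.finrank ℚ_[p] ℚ_[p]⟮ζ⟯ * p ^ (n * (d - 1))) ∧
    (((∃ f : Iwasawa.completedGroupAlgebra ℤ_[p] Γ,
          J = Ideal.span {f} ∧ ∀ s, Iwasawa.IsSimpleElement p s → ¬ s ∣ f) ∨
        (∃ f g : Iwasawa.completedGroupAlgebra ℤ_[p] Γ,
          IsRelPrime f g ∧ Ideal.span {f, g} ≤ J)) →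
      (fun n : ℕ => (Module.finrank ℤ_[p]
          (Iwasawa.completedGroupAlgebra ℤ_[p] Γ ⧸ (Iwasawa.layerIdeal e n ⊔ J)) : ℝ))
        =O[atTop] fun n : ℕ => Iwasawa.errorTerm p d n) := by
  obtain ⟨d, rfl⟩ := Nat.exists_eq_add_of_le' hd
  refine ⟨?_, fun h => Iwasawa.isBigO_finrank_quotient e fun s hs hle => ?_⟩
  · rintro γ ζ m hγ ⟨k, hk⟩ hm rfl
    filter_upwards [eventually_ge_atTop k] with n hn
    obtain ⟨c, hc⟩ := pow_dvd_pow p hn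
    exact Iwasawa.finrank_quotient_span_simpleElement_pow e hγ hm
      (by rw [hc, pow_mul, hk, one_pow])
  · rcases h with ⟨f, rfl, hf⟩ | ⟨f, g, hfg, hJ⟩
    · exact hf s hs (Ideal.mem_span_singleton.1 (hle (Ideal.mem_span_singleton_self f)))
    · refine Iwasawa.not_isUnit_of_isSimpleElement e hs (hfg ?_ ?_)
      · exact Ideal.mem_span_singleton.1 (hle (hJ (Ideal.subset_span (Set.mem_insert f {g}))))
      · exact Ideal.mem_span_singleton.1
          (hle (hJ (Ideal.subset_span (Set.mem_insert_of_mem f rfl))))
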